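/- Let $R$ be a commutative Noetherian local ring which is complete with respect to its maximal ideal, let $\Lambda$ be an $R$-algebra (not necessarily commutative) which is finitely generated as an $R$-module, and let $\mathfrak a$ be a proper ideal of $R$ such that $\operatorname{Tor}_i^R(\Lambda,R/\mathfrak a)=0$ for all $i>0$. For a ring $A$ write $\operatorname{mod} A$ for the category of finitely generated right $A$-modules, $D(A)$ for the derived category of all right $A$-modules, and $D^-$ for the bounded above derived category. Suppose that $R$ is normally flat along $\mathfrak a$, that is, $\mathfrak a^n/\mathfrak a^{n+1}$ is a flat $R/\mathfrak a$-module for every integer $n>0$. Then $$\operatorname{Tor}_i^R(\Lambda,R/\mathfrak a^n)=0\qquad\text{for all integers } i>0 \text{ and } n\ge 0.$$ Moreover, for every complex $P\in D^-(\operatorname{mod}\Lambda/\mathfrak a\Lambda)$ with $\operatorname{Hom}_{D(\Lambda/\mathfrak a\Lambda)}(P,P[2])=0$ there is a complex $L\in D^-(\operatorname{mod}\Lambda)$ such that $L\otimes^{\mathbb L}_{\Lambda}\Lambda/\mathfrak a\Lambda\cong P$ in $D^-(\operatorname{mod}\Lambda/\mathfrak a\Lambda)$. -/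

import Mathlib

open CategoryTheory Limits
open scoped TensorProduct

universe w₁ w₂ w₃ v₁ v₂ u u₁ u₂

namespace CochainComplex

variable {C : Type*} [Category* C] [Abelian C]

lemma quasiIso_of_quasiIso_opEquivalence {K L : CochainComplex C ℤ} (f : K ⟶ L)
    [hf : QuasiIso ((opEquivalence C).functor.map f.op)] : QuasiIso f := by
  rw [quasiIso_iff]
  intro n
  obtain ⟨m, rfl⟩ : ∃ m, n = -m := ⟨-n, by simp⟩
  have h := hf.quasiIsoAt m
  rw [quasiIsoAt_iff' _ (m - 1) m (m + 1) (by simp) (by simp)] at h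
  rw [quasiIsoAt_iff' _ (-(m + 1)) (-m) (-(m - 1)) (by grind [prev]) (by grind [next])]
  exact (ShortComplex.quasiIso_opMap_iff
    ((HomologicalComplex.shortComplexFunctor' C (ComplexShape.up ℤ) _ _ _).map f)).1 h

/-- In an abelian category with enough projectives, a cochain complex which is concentrated in
degrees `≤ n` is quasi-isomorphic to a complex of projectives concentrated in degrees `≤ n`. -/
lemma exists_quasiIso_projective [EnoughProjectives C] (K : CochainComplex C ℤ) (n : ℤ)
    [K.IsStrictlyLE n] :
    ∃ (P : CochainComplex C ℤ) (p : P ⟶ K), QuasiIso p ∧ (∀ i, Projective (P.X i)) ∧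
      P.IsStrictlyLE n := by
  let K' := (opEquivalence C).functor.obj (Opposite.op K)
  have : K'.IsStrictlyGE (-n) := by
    rw [isStrictlyGE_iff]
    intro i hi
    exact (K.isZero_of_isStrictlyLE n (-i) (by lia)).op
  obtain ⟨L, i, _, hL, _⟩ :=
    CochainComplex.Plus.modelCategoryQuillen.exists_quasiIso_injective K' (-n)
  let P : CochainComplex C ℤ := ((opEquivalence C).inverse.obj L).unop
  let e : (opEquivalence C).functor.obj (Opposite.op P) ≅ L := (opEquivalence C).counitIso.app L
  let p : P ⟶ K := ((opEquivalence C).functor.preimage (i ≫ e.inv)).unop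
  have hp : (opEquivalence C).functor.map p.op = i ≫ e.inv :=
    (opEquivalence C).functor.map_preimage _
  have eX (q : ℤ) : Opposite.op (P.X (-q)) ≅ L.X q := (HomologicalComplex.eval _ _ q).mapIso e
  refine ⟨P, p, ?_, fun q ↦ ?_, ?_⟩
  · have : QuasiIso ((opEquivalence C).functor.map p.op) := by
      rw [hp]; infer_instance
    exact quasiIso_of_quasiIso_opEquivalence p
  · obtain ⟨q, rfl⟩ : ∃ m, q = -m := ⟨-q, by simp⟩
    have := hL q
    have : Injective (Opposite.op (P.X (-q))) := Injective.of_iso (eX q).symm inferInstance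
    exact Injective.projective_iff_injective_op.2 this
  · rw [isStrictlyLE_iff]
    intro q hq
    obtain ⟨q, rfl⟩ : ∃ m, q = -m := ⟨-q, by simp⟩
    exact ((L.isZero_of_isStrictlyGE (-n) q (by lia)).of_iso (eX q)).unop

end CochainComplex

namespace HomotopyCategory

/-- The property of objects of the homotopy category whose underlying cochain complex is
bounded above. -/
def minus (C : Type*) [Category* C] [Abelian C] :
    ObjectProperty (HomotopyCategory C (ComplexShape.up ℤ)) :=
  fun K ↦ ∃ n : ℤ, CochainComplex.IsStrictlyLE K.as n

/-- The homotopy category of bounded above cochain complexes. -/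
abbrev Minus (C : Type*) [Category* C] [Abelian C] := (minus C).FullSubcategory

end HomotopyCategory

namespace DerivedCategory.Minus

variable {C : Type u₁} [Category.{v₁} C] [Abelian C] [HasDerivedCategory.{w₁} C]

/-- The localization functor from the bounded above homotopy category to the
bounded above derived category. -/
noncomputable def Qh : HomotopyCategory.Minus C ⥤ DerivedCategory.Minus C :=
  TStructure.t.minus.lift ((HomotopyCategory.minus C).ι ⋙ DerivedCategory.Qh) (by
    rintro ⟨K, n, hn⟩
    obtain ⟨K, rfl⟩ := HomotopyCategory.quotient_obj_surjective K
    exact ⟨n, K, (quotientCompQhIso C).app K, hn⟩)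

/-- Every object of the bounded above derived category is represented by a bounded above complex
of projectives. -/
lemma exists_projective [EnoughProjectives C] (X : DerivedCategory.Minus C) :
    ∃ P : HomotopyCategory.Minus C, (∀ i, Projective (P.obj.as.X i)) ∧
      Nonempty (Qh.obj P ≅ X) := by
  obtain ⟨X, n, K, e, hn⟩ := X
  obtain ⟨P, p, _, hP, h⟩ := CochainComplex.exists_quasiIso_projective K n
  exact ⟨⟨(HomotopyCategory.quotient _ _).obj P, n, h⟩, hP,
    ⟨DerivedCategory.Minus.ι.preimageIso
      ((quotientCompQhIso C).app P ≪≫ asIso (DerivedCategory.Q.map p) ≪≫ e.symm)⟩⟩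

/-- Morphisms out of a bounded above complex of projectives are the same in the homotopy category
and in the derived category. -/
lemma Qh_map_bijective (P K : HomotopyCategory.Minus C) (hP : ∀ i, Projective (P.obj.as.X i)) :
    Function.Bijective (Qh.map : (P ⟶ K) → _) := by
  have : CochainComplex.IsKProjective P.obj.as :=
    have := P.property.choose_spec
    CochainComplex.isKProjective_of_projective _ P.property.choose
  have := CochainComplex.IsKProjective.Qh_map_bijective P.obj.as K.obj
  replace this := this.comp ((HomotopyCategory.minus C).fullyFaithfulι.map_bijective P K)
  rwa [← Function.Bijective.of_comp_iff' (TStructure.t.minus.fullyFaithfulι.map_bijective _ _)]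

/-- If `P` is a bounded above complex of projectives, then `(P, 𝟙)` is initial among the pairs
consisting of a bounded above complex `K` and a morphism `P ⟶ K` in the derived category. -/
noncomputable def isInitialMk (P : HomotopyCategory.Minus C)
    (hP : ∀ i, Projective (P.obj.as.X i)) :
    IsInitial (StructuredArrow.mk (𝟙 (Qh.obj P)) : StructuredArrow (Qh.obj P) Qh) :=
  IsInitial.ofUniqueHom
    (fun Y ↦ StructuredArrow.homMk ((Qh_map_bijective P Y.right hP).2 Y.hom).choose (by
      simpa using ((Qh_map_bijective P Y.right hP).2 Y.hom).choose_spec))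
    (fun Y f ↦ by
      apply StructuredArrow.hom_ext
      apply (Qh_map_bijective P Y.right hP).1
      refine Eq.trans ?_ ((Qh_map_bijective P Y.right hP).2 Y.hom).choose_spec.symm
      simpa using (StructuredArrow.w f))

instance [EnoughProjectives C] {E : Type*} [Category* E] (G : HomotopyCategory.Minus C ⥤ E) :
    (Qh (C := C)).HasPointwiseRightKanExtension G := by
  intro X
  obtain ⟨P, hP, ⟨e⟩⟩ := exists_projective X
  rw [← Functor.hasPointwiseRightKanExtensionAt_iff_of_iso _ G e]
  have := (isInitialMk P hP).hasInitial
  unfold Functor.HasPointwiseRightKanExtensionAt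
  infer_instance

/-- On a bounded above complex of projectives, the right Kan extension of a functor `G` on the
bounded above homotopy category takes the same value as `G`. -/
lemma isIso_rightKanExtensionCounit_app [EnoughProjectives C] {E : Type*} [Category* E]
    (G : HomotopyCategory.Minus C ⥤ E) (P : HomotopyCategory.Minus C)
    (hP : ∀ i, Projective (P.obj.as.X i)) :
    IsIso ((Qh.rightKanExtensionCounit G).app P) := by
  have h := (Functor.isPointwiseRightKanExtensionOfIsRightKanExtension _
    (Qh.rightKanExtensionCounit G)) (Qh.obj P)
  have := IsLimit.isIso_π_app_of_isInitial h _ (isInitialMk P hP)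
  refine (congrArg (fun t ↦ IsIso t) ?_).mp this
  exact (congrArg (· ≫ _) (CategoryTheory.Functor.map_id _ _)).trans (Category.id_comp _)

end DerivedCategory.Minus

namespace CategoryTheory.Functor

variable {C : Type u₁} [Category.{v₁} C] [Abelian C] [HasDerivedCategory.{w₁} C]
  {D : Type u₂} [Category.{v₂} D] [Abelian D] [HasDerivedCategory.{w₂} D]
  (F : C ⥤ D) [F.Additive]

/-- The functor between bounded above homotopy categories which applies `F` in each degree. -/
noncomputable def mapHomotopyCategoryMinus :
    HomotopyCategory.Minus C ⥤ HomotopyCategory.Minus D :=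
  (HomotopyCategory.minus D).lift
    ((HomotopyCategory.minus C).ι ⋙ F.mapHomotopyCategory (ComplexShape.up ℤ)) (by
    rintro ⟨K, n, hn⟩
    obtain ⟨K, rfl⟩ := HomotopyCategory.quotient_obj_surjective K
    have : CochainComplex.IsStrictlyLE K n := hn
    exact ⟨n, (CochainComplex.isStrictlyLE_iff _ _).2 fun i hi ↦
      F.map_isZero (CochainComplex.isZero_of_isStrictlyLE K n i hi)⟩)

/-- The total left derived functor `𝕃F : D⁻(C) ⥤ D⁻(D)` of an additive functor `F : C ⥤ D`, when `C`
has enough projectives: the right Kan extension, along the localization functor `K⁻(C) ⥤ D⁻(C)`,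
of the functor `K⁻(C) ⥤ K⁻(D) ⥤ D⁻(D)` which applies `F` in each degree. It exists, and it is
computed by bounded above complexes of projectives, by the results above. -/
noncomputable def leftDerivedFunctorMinus [EnoughProjectives C] :
    DerivedCategory.Minus C ⥤ DerivedCategory.Minus D :=
  DerivedCategory.Minus.Qh.rightKanExtension
    (F.mapHomotopyCategoryMinus ⋙ DerivedCategory.Minus.Qh)

end CategoryTheory.Functor


section ExtendScalars

variable {A B : Type u} [Ring A] [Ring B] (f : A →+* B)

/-- The relations `(m · a) ⊗ b = m ⊗ (f(a) b)` which define the tensor product `M ⊗_A B` of a right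
`A`-module `M` with the `A`-`B`-bimodule `B`, as a quotient of the tensor product over `ℤ`. Right
modules are modules over the opposite ring. The factor `B` is written on the left only because
Mathlib lets a ring act on the left factor of a tensor product: here `B` acts from the right on
`B ⊗ M` by `(b ⊗ m) · b' = (b b') ⊗ m`. -/
def extendScalarsRel (M : Type u) [AddCommGroup M] [Module Aᵐᵒᵖ M] :
    Submodule Bᵐᵒᵖ (B ⊗[ℤ] M) :=
  Submodule.span Bᵐᵒᵖ
    {x | ∃ (a : A) (b : B) (m : M), x = (f a * b) ⊗ₜ[ℤ] m - b ⊗ₜ[ℤ] (MulOpposite.op a • m)}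

/-- The right `B`-module `M ⊗_A B` for a ring homomorphism `f : A →+* B` and a right `A`-module
`M`. -/
abbrev ExtendScalars (M : Type u) [AddCommGroup M] [Module Aᵐᵒᵖ M] : Type u :=
  (B ⊗[ℤ] M) ⧸ extendScalarsRel f M

/-- The `B`-linear map `g ⊗_A B : M ⊗_A B → N ⊗_A B` induced by an `A`-linear map `g : M → N`. -/
def extendScalarsMap {M N : Type u} [AddCommGroup M] [Module Aᵐᵒᵖ M] [AddCommGroup N]
    [Module Aᵐᵒᵖ N] (g : M →ₗ[Aᵐᵒᵖ] N) : ExtendScalars f M →ₗ[Bᵐᵒᵖ] ExtendScalars f N :=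
  Submodule.mapQ _ _
    (TensorProduct.AlgebraTensorModule.map (LinearMap.id : B →ₗ[Bᵐᵒᵖ] B)
      g.toAddMonoidHom.toIntLinearMap) (by
    rw [extendScalarsRel, Submodule.span_le]
    rintro _ ⟨a, b, m, rfl⟩
    refine Submodule.subset_span ⟨a, b, g m, ?_⟩
    simp)

@[simp]
lemma extendScalarsMap_mk_tmul {M N : Type u} [AddCommGroup M] [Module Aᵐᵒᵖ M] [AddCommGroup N]
    [Module Aᵐᵒᵖ N] (g : M →ₗ[Aᵐᵒᵖ] N) (b : B) (m : M) :
    extendScalarsMap f g (Submodule.Quotient.mk (b ⊗ₜ[ℤ] m)) =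
      Submodule.Quotient.mk (b ⊗ₜ[ℤ] g m) := rfl

lemma extendScalars_hom_ext {M : Type u} [AddCommGroup M] [Module Aᵐᵒᵖ M] {N : Type u}
    [AddCommGroup N] [Module Bᵐᵒᵖ N] {g h : ExtendScalars f M →ₗ[Bᵐᵒᵖ] N}
    (H : ∀ (b : B) (m : M), g (Submodule.Quotient.mk (b ⊗ₜ[ℤ] m)) =
      h (Submodule.Quotient.mk (b ⊗ₜ[ℤ] m))) : g = h := by
  refine LinearMap.ext fun x ↦ ?_
  obtain ⟨x, rfl⟩ := Submodule.Quotient.mk_surjective _ x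
  induction x with
  | zero => rw [Submodule.Quotient.mk_zero, map_zero, map_zero]
  | add x y hx hy => rw [Submodule.Quotient.mk_add, map_add, map_add, hx, hy]
  | tmul b m => exact H b m

instance finite_extendScalars (M : Type u) [AddCommGroup M] [Module Aᵐᵒᵖ M]
    [Module.Finite Aᵐᵒᵖ M] : Module.Finite Bᵐᵒᵖ (ExtendScalars f M) := by
  classical
  obtain ⟨s, hs⟩ := Module.Finite.fg_top (R := Aᵐᵒᵖ) (M := M)
  let q := (extendScalarsRel f M).mkQ
  let t : Finset (ExtendScalars f M) := s.image fun m ↦ q ((1 : B) ⊗ₜ[ℤ] m)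
  refine ⟨⟨t, ?_⟩⟩
  set S := Submodule.span Bᵐᵒᵖ (t : Set (ExtendScalars f M)) with hS
  have key (m : M) : ∀ b : B, q (b ⊗ₜ[ℤ] m) ∈ S := by
    have hm : m ∈ Submodule.span Aᵐᵒᵖ (s : Set M) := hs ▸ Submodule.mem_top
    induction hm using Submodule.span_induction with
    | mem m hm =>
      intro b
      have h : q ((1 : B) ⊗ₜ[ℤ] m) ∈ S := Submodule.subset_span (by
        exact Finset.mem_coe.2 (Finset.mem_image_of_mem _ hm))
      simpa [← map_smul, TensorProduct.smul_tmul'] using S.smul_mem (MulOpposite.op b) h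
    | zero => intro b; simp
    | add x y _ _ hx hy =>
      intro b
      rw [TensorProduct.tmul_add, map_add]
      exact S.add_mem (hx b) (hy b)
    | smul a m _ hm =>
      intro b
      have : q ((f a.unop * b) ⊗ₜ[ℤ] m) = q (b ⊗ₜ[ℤ] (a • m)) := by
        rw [← sub_eq_zero, ← map_sub]
        exact (Submodule.Quotient.mk_eq_zero _).2 (Submodule.subset_span ⟨a.unop, b, m, rfl⟩)
      exact this ▸ hm _
  rw [eq_top_iff]
  rintro x -
  obtain ⟨x, rfl⟩ := (extendScalarsRel f M).mkQ_surjective x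
  induction x with
  | zero => simp
  | add x y hx hy => rw [map_add]; exact S.add_mem hx hy
  | tmul b m => exact key m b

end ExtendScalars

section

variable {R Λ : Type u} [CommRing R] [Ring Λ] [Algebra R Λ] (𝔞 : Ideal R)

/-- Since the image of `R` in an `R`-algebra `Λ` is central, the ideal `𝔞Λ` is two-sided. -/
instance Ideal.isTwoSided_map_algebraMap : (𝔞.map (algebraMap R Λ)).IsTwoSided := by
  constructor
  intro a b ha
  induction ha using Submodule.span_induction with
  | mem x hx =>
    obtain ⟨r, hr, rfl⟩ := hx
    rw [Algebra.commutes]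
    exact Ideal.mul_mem_left _ _ (Ideal.mem_map_of_mem _ hr)
  | zero => simp
  | add x y _ _ hx hy => rw [add_mul]; exact add_mem hx hy
  | smul c x _ hx => rw [smul_eq_mul, mul_assoc]; exact Ideal.mul_mem_left _ _ hx

end

namespace FGModuleCat

variable (A : Type u) [Ring A]

instance : (forget₂ (FGModuleCat.{u} A) (ModuleCat.{u} A)).Additive where

instance [IsNoetherianRing A] : EnoughProjectives (FGModuleCat.{u} A) where
  presentation X := by
    obtain ⟨n, g, hg⟩ := Module.Finite.exists_fin' A X
    have hP : Projective (FGModuleCat.of A (Fin n → A)) :=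
      { factors := fun {E X} f e he ↦ by
          have : Epi ((forget₂ (FGModuleCat.{u} A) (ModuleCat.{u} A)).map e) := inferInstance
          have he' : Function.Surjective e.hom.hom := (ModuleCat.epi_iff_surjective _).1 this
          obtain ⟨h, hh⟩ := Module.projective_lifting_property e.hom.hom f.hom.hom he'
          exact ⟨FGModuleCat.ofHom h, FGModuleCat.hom_ext hh⟩ }
    have : Epi ((forget₂ (FGModuleCat.{u} A) (ModuleCat.{u} A)).map (FGModuleCat.ofHom g)) :=
      (ModuleCat.epi_iff_surjective _).2 hg
    have := (forget₂ (FGModuleCat.{u} A) (ModuleCat.{u} A)).epi_of_epi_map this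
    exact ⟨{ p := FGModuleCat.of A (Fin n → A), f := FGModuleCat.ofHom g }⟩

end FGModuleCat

/-- The category `mod Λ` of finitely generated right modules over an `R`-algebra `Λ`. It does not
depend on `R`; the base ring is recorded so that Lean knows that `mod Λ` is abelian when `R` is
noetherian and `Λ` is a finitely generated `R`-module. -/
def FGRightMod (R Λ : Type u) [CommRing R] [Ring Λ] [Algebra R Λ] : Type (u + 1) :=
  FGModuleCat.{u} Λᵐᵒᵖ

namespace FGRightMod

variable (R : Type u) {Λ Γ : Type u} [CommRing R] [Ring Λ] [Algebra R Λ] [Ring Γ] [Algebra R Γ]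

instance : Category.{u} (FGRightMod R Λ) := inferInstanceAs (Category.{u} (FGModuleCat.{u} Λᵐᵒᵖ))

instance : Preadditive (FGRightMod R Λ) := inferInstanceAs (Preadditive (FGModuleCat.{u} Λᵐᵒᵖ))

variable (Λ) in
lemma isNoetherianRing_op [IsNoetherianRing R] [Module.Finite R Λ] : IsNoetherianRing Λᵐᵒᵖ :=
  IsNoetherianRing.of_finite R _

noncomputable instance [IsNoetherianRing R] [Module.Finite R Λ] : Abelian (FGRightMod R Λ) :=
  have := isNoetherianRing_op R Λ
  inferInstanceAs (Abelian (FGModuleCat.{u} Λᵐᵒᵖ))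

instance [IsNoetherianRing R] [Module.Finite R Λ] : EnoughProjectives (FGRightMod R Λ) :=
  have := isNoetherianRing_op R Λ
  inferInstanceAs (EnoughProjectives (FGModuleCat.{u} Λᵐᵒᵖ))

variable (Λ) in
/-- The inclusion of `mod Λ` in the category `Mod Λ` of all right `Λ`-modules. -/
def toModuleCat : FGRightMod R Λ ⥤ ModuleCat.{u} Λᵐᵒᵖ :=
  forget₂ (FGModuleCat.{u} Λᵐᵒᵖ) (ModuleCat.{u} Λᵐᵒᵖ)

instance : (toModuleCat R Λ).Additive where

instance (M : FGRightMod R Λ) : Module.Finite Λᵐᵒᵖ ((toModuleCat R Λ).obj M) :=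
  FGModuleCat.instFiniteCarrier Λᵐᵒᵖ M

instance [IsNoetherianRing R] [Module.Finite R Λ] : PreservesFiniteLimits (toModuleCat R Λ) :=
  have := isNoetherianRing_op R Λ
  inferInstanceAs (PreservesFiniteLimits (forget₂ (FGModuleCat.{u} Λᵐᵒᵖ) (ModuleCat.{u} Λᵐᵒᵖ)))

instance : PreservesFiniteColimits (toModuleCat R Λ) :=
  inferInstanceAs (PreservesFiniteColimits (forget₂ (FGModuleCat.{u} Λᵐᵒᵖ) (ModuleCat.{u} Λᵐᵒᵖ)))

/-- The functor `- ⊗_Λ Γ : mod Λ ⥤ mod Γ` for a homomorphism `Λ → Γ` of `R`-algebras. -/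
def extendScalars (f : Λ →ₐ[R] Γ) : FGRightMod R Λ ⥤ FGRightMod R Γ where
  obj M := FGModuleCat.of Γᵐᵒᵖ (ExtendScalars f.toRingHom ((toModuleCat R Λ).obj M))
  map g := FGModuleCat.ofHom (extendScalarsMap f.toRingHom ((toModuleCat R Λ).map g).hom)
  map_id M := by
    apply FGModuleCat.hom_ext
    exact extendScalars_hom_ext _ fun b m ↦ rfl
  map_comp g h := by
    apply FGModuleCat.hom_ext
    exact extendScalars_hom_ext _ fun b m ↦ rfl

instance (f : Λ →ₐ[R] Γ) : (extendScalars R f).Additive where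
  map_add {M N g h} := by
    apply FGModuleCat.hom_ext
    refine extendScalars_hom_ext _ fun b m ↦ ?_
    exact congrArg Submodule.Quotient.mk (TensorProduct.tmul_add b (g.hom.hom m) (h.hom.hom m))

/-- The functor `- ⊗_Λ Λ/𝔞Λ : mod Λ ⥤ mod Λ/𝔞Λ` for an ideal `𝔞` of `R`. -/
def reduction (Λ : Type u) [Ring Λ] [Algebra R Λ] (𝔞 : Ideal R) :
    FGRightMod R Λ ⥤ FGRightMod R (Λ ⧸ 𝔞.map (algebraMap R Λ)) :=
  extendScalars R (Ideal.Quotient.mkₐ R (𝔞.map (algebraMap R Λ)))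

instance (Λ : Type u) [Ring Λ] [Algebra R Λ] (𝔞 : Ideal R) : (reduction R Λ 𝔞).Additive :=
  inferInstanceAs (extendScalars R (Ideal.Quotient.mkₐ R (𝔞.map (algebraMap R Λ)))).Additive

end FGRightMod

section Conditions

variable {R : Type u} [CommRing R]

/-- The condition `Tor_i^R(M, N) = 0` for all integers `i > 0`. -/
def TorIndependent (R : Type u) [CommRing R] (M N : Type u) [AddCommGroup M] [Module R M]
    [AddCommGroup N] [Module R N] : Prop :=
  ∀ i : ℕ, 0 < i → IsZero (((Tor (ModuleCat.{u} R) i).obj (ModuleCat.of R M)).obj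
    (ModuleCat.of R N))

/-- `R` is normally flat along `𝔞` if `𝔞ⁿ/𝔞ⁿ⁺¹` is a flat `R/𝔞`-module for all `n > 0`. The quotient
`𝔞ⁿ/𝔞ⁿ⁺¹` is formed as `𝔞ⁿ/(𝔞 · 𝔞ⁿ)`. -/
def IsNormallyFlat (𝔞 : Ideal R) : Prop :=
  ∀ n : ℕ, 0 < n → Module.Flat (R ⧸ 𝔞) (↥(𝔞 ^ n) ⧸ (𝔞 • ⊤ : Submodule R ↥(𝔞 ^ n)))

/-- The submodule `𝔞 · 𝔞ⁿ` of `𝔞ⁿ` consists of the elements that lie in `𝔞ⁿ⁺¹`. -/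
lemma smul_top_pow_eq (𝔞 : Ideal R) (n : ℕ) :
    (𝔞 • ⊤ : Submodule R ↥(𝔞 ^ n)) =
      Submodule.comap (Submodule.subtype (𝔞 ^ n)) (𝔞 ^ (n + 1)) := by
  apply Submodule.map_injective_of_injective (Submodule.subtype_injective (𝔞 ^ n))
  rw [Submodule.map_smul'', Submodule.map_top, Submodule.range_subtype,
    Submodule.map_comap_subtype, inf_eq_right.2 (Ideal.pow_le_pow_right n.le_succ), pow_succ',
    smul_eq_mul]

end Conditions

/-! The first assertion is an induction along `0 → 𝔞ⁿ/𝔞ⁿ⁺¹ → R/𝔞ⁿ⁺¹ → R/𝔞ⁿ → 0`. The graded piece is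
finitely generated and flat over the local ring `R/𝔞`, hence a finite power of `R/𝔞`, so the
`Tor`-vanishing passes from `R/𝔞` and `R/𝔞ⁿ` to `R/𝔞ⁿ⁺¹` (`TorIndependent.quotient_pow`). Since
`Tor₁(Λ, R/𝔞ⁿ) = 0`, the sequence stays exact on the left after tensoring with `Λ`. Hence finitely
many elements `x j` of `𝔞ⁿ`, central in `Λ`, form a basis of `𝔞ⁿΛ/𝔞ⁿ⁺¹Λ` over `Λ/𝔞Λ`
(`IsNormallyFlat.exists_basis`).

For the lifting, `P` is represented by a bounded above complex of finite free modules, that is, by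
matrices over `Λ/𝔞Λ`, which are lifted arbitrarily to matrices `d` over `Λ`. If `d² ≡ 0` modulo
`𝔞ᵏ`, write `d² ≡ ∑ x j • f j` modulo `𝔞ᵏ⁺¹`. From `d · d² = d² · d` and the independence of the `x
j`, each `f j` is modulo `𝔞` a cocycle of degree two. The hypothesis on `P` gives `f j ≡ d h j + h j
d`, and `d - ∑ x j • h j` squares to zero modulo `𝔞ᵏ⁺¹`
(`IsUnobstructed.exists_sub_mem_of_mul_mem`). By completeness the corrections converge to an honest
complex over `Λ` (`IsUnobstructed.exists_lift`). It consists of free modules, so its derived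
reduction is its reduction, which is `P`. -/

/-! ### Left derived functors of left adjoints, tested by `Ext`. -/

namespace CategoryTheory

/-- Exactness in an abelian category with enough injectives can be tested by mapping to injective
objects. -/
lemma ShortComplex.exact_iff_forall_injective {C : Type u₁} [Category.{v₁} C] [Abelian C]
    [EnoughInjectives C] (S : ShortComplex C) :
    S.Exact ↔ ∀ (E : C) [Injective E] (f : S.X₂ ⟶ E), S.f ≫ f = 0 → ∃ g, S.g ≫ g = f := by
  refine ⟨fun h E _ f hf ↦ ⟨h.descToInjective f hf, h.comp_descToInjective f hf⟩, fun h ↦ ?_⟩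
  -- Embed the cokernel of `S.f` in an injective: if this test map factors through `S.g`, it
  -- vanishes on the kernel of `S.g`.
  obtain ⟨g, hg⟩ := h (Injective.under (cokernel S.f)) (cokernel.π S.f ≫ Injective.ι _) (by simp)
  rw [S.exact_iff_kernel_ι_comp_cokernel_π_zero, ← cancel_mono (Injective.ι _), Category.assoc,
    ← hg]
  simp

namespace Adjunction

variable {C : Type u₁} [Category.{v₁} C] [Abelian C] [HasExt.{w₁} C]
  {D : Type u₂} [Category.{v₂} D] [Abelian D] [EnoughInjectives D]
  {F : C ⥤ D} {G : D ⥤ C} [F.Additive]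

/-- The vanishing of a left derived functor of a left adjoint `F` is tested by the vanishing
of `Ext`-groups into the images of injective objects by the right adjoint. -/
lemma isZero_leftDerived_obj_iff [HasProjectiveResolutions C] (adj : F ⊣ G) (X : C) (i : ℕ) :
    IsZero ((F.leftDerived (i + 1)).obj X) ↔
      ∀ (E : D) [Injective E], Subsingleton (Abelian.Ext X (G.obj E) (i + 1)) := by
  let P := projectiveResolution X
  have : G.PreservesZeroMorphisms :=
    have := adj.right_adjoint_additive
    inferInstance
  rw [(P.isoLeftDerivedObj F (i + 1)).isZero_iff, HomologicalComplex.homologyFunctor_obj,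
    ← HomologicalComplex.exactAt_iff_isZero_homology,
    HomologicalComplex.exactAt_iff' _ (i + 2) (i + 1) i (by simp) (by simp),
    ShortComplex.exact_iff_forall_injective]
  -- By adjunction, this says that every cocycle `P_{i+1} ⟶ G E` is a coboundary, which is the
  -- vanishing of `Ext`.
  change (∀ (E : D) [Injective E] (f : F.obj (P.complex.X (i + 1)) ⟶ E),
    F.map (P.complex.d (i + 2) (i + 1)) ≫ f = 0 →
      ∃ g : F.obj (P.complex.X i) ⟶ E, F.map (P.complex.d (i + 1) i) ≫ g = f) ↔ _
  refine forall₂_congr fun E _ ↦ ⟨fun h ↦ ?_, fun h f hf ↦ ?_⟩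
  · refine subsingleton_of_forall_eq 0 fun x ↦ ?_
    obtain ⟨f, hf, rfl⟩ := P.extMk_surjective x (i + 2) rfl
    rw [P.extMk_eq_zero_iff f _ _ hf i rfl]
    obtain ⟨g, hg⟩ := h ((adj.homEquiv _ _).symm f) (by
      rw [← adj.homEquiv_naturality_left_symm, hf]
      simp [homEquiv_counit])
    refine ⟨adj.homEquiv _ _ g, ?_⟩
    rw [← adj.homEquiv_naturality_left, hg, Equiv.apply_symm_apply]
  · have hf' : P.complex.d (i + 2) (i + 1) ≫ adj.homEquiv _ _ f = 0 := by
      rw [← adj.homEquiv_naturality_left, hf]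
      simp [homEquiv_unit]
    obtain ⟨g, hg⟩ := (P.extMk_eq_zero_iff _ _ rfl hf' i rfl).1 (Subsingleton.elim _ _)
    refine ⟨(adj.homEquiv _ _).symm g, ?_⟩
    rw [← adj.homEquiv_naturality_left_symm, hg, Equiv.symm_apply_apply]

variable {S : ShortComplex C} (hS : S.ShortExact)

-- By the adjunction criterion, this is exactness at the middle term of the contravariant `Ext`
-- sequence.
include hS in
lemma isZero_leftDerived_obj_X₂ [HasProjectiveResolutions C] (adj : F ⊣ G) (i : ℕ)
    (h₁ : IsZero ((F.leftDerived (i + 1)).obj S.X₁))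
    (h₃ : IsZero ((F.leftDerived (i + 1)).obj S.X₃)) :
    IsZero ((F.leftDerived (i + 1)).obj S.X₂) := by
  rw [isZero_leftDerived_obj_iff adj] at h₁ h₃ ⊢
  intro E _
  have := h₁ E
  have := h₃ E
  refine subsingleton_of_forall_eq 0 fun x ↦ ?_
  obtain ⟨y, rfl⟩ := Abelian.Ext.contravariant_sequence_exact₂ hS _ x (Subsingleton.elim _ _)
  rw [Subsingleton.elim y 0, Abelian.Ext.comp_zero]

-- Embed `F X₁` in an injective `E`. The obstruction to extending the transpose `X₁ ⟶ G E` along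
-- `S.f` lies in `Ext¹(X₃, G E) = 0`. Transposing the extension back factors a monomorphism through
-- `F.map S.f`.
include hS in
lemma mono_map_f_of_isZero_leftDerived_obj [HasProjectiveResolutions C] (adj : F ⊣ G)
    (h : IsZero ((F.leftDerived 1).obj S.X₃)) : Mono (F.map S.f) := by
  rw [isZero_leftDerived_obj_iff adj] at h
  have := h (Injective.under (F.obj S.X₁))
  obtain ⟨y, hy⟩ := Abelian.Ext.contravariant_sequence_exact₁ hS _
    (Abelian.Ext.mk₀ (adj.homEquiv _ _ (Injective.ι (F.obj S.X₁)))) rfl (Subsingleton.elim _ _)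
  obtain ⟨g, rfl⟩ := (Abelian.Ext.mk₀_bijective _ _).2 y
  rw [Abelian.Ext.mk₀_comp_mk₀] at hy
  replace hy := (Abelian.Ext.mk₀_bijective _ _).1 hy
  have : F.map S.f ≫ (adj.homEquiv _ _).symm g = Injective.ι (F.obj S.X₁) := by
    rw [← adj.homEquiv_naturality_left_symm, hy, Equiv.symm_apply_apply]
  exact mono_of_mono_fac this

end Adjunction

end CategoryTheory

/-! ### Permanence of `Tor`-independence. -/

section Tor

variable {R : Type u} [CommRing R] (M : Type u) [AddCommGroup M] [Module R M]
  {N₁ N₂ N₃ : Type u} [AddCommGroup N₁] [Module R N₁] [AddCommGroup N₂] [Module R N₂]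
  [AddCommGroup N₃] [Module R N₃]

lemma shortExact_of_exact {f : N₁ →ₗ[R] N₂} {g : N₂ →ₗ[R] N₃} (hf : Function.Injective f)
    (hfg : Function.Exact f g) (hg : Function.Surjective g) :
    (ShortComplex.mk (ModuleCat.ofHom f) (ModuleCat.ofHom g) (by
      ext x; exact hfg.apply_apply_eq_zero x)).ShortExact where
  exact := (ShortComplex.ShortExact.moduleCat_exact_iff_function_exact _).2 hfg
  mono_f := (ModuleCat.mono_iff_injective _).2 hf
  epi_g := (ModuleCat.epi_iff_surjective _).2 hg

variable {M}

/-- `Tor` is derived from `M ⊗ -`, a left adjoint of the internal Hom, so the adjunction criterion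
applies. -/
lemma TorIndependent.of_exact {f : N₁ →ₗ[R] N₂} {g : N₂ →ₗ[R] N₃} (hf : Function.Injective f)
    (hfg : Function.Exact f g) (hg : Function.Surjective g)
    (h₁ : TorIndependent R M N₁) (h₃ : TorIndependent R M N₃) : TorIndependent R M N₂ := by
  rintro (_ | i) hi
  · exact absurd hi (lt_irrefl 0)
  · exact Adjunction.isZero_leftDerived_obj_X₂ (shortExact_of_exact hf hfg hg)
      (ihom.adjunction (ModuleCat.of R M)) i (h₁ _ hi) (h₃ _ hi)

lemma TorIndependent.lTensor_injective {f : N₁ →ₗ[R] N₂} {g : N₂ →ₗ[R] N₃}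
    (hf : Function.Injective f) (hfg : Function.Exact f g) (hg : Function.Surjective g)
    (h₃ : TorIndependent R M N₃) : Function.Injective (f.lTensor M) :=
  (ModuleCat.mono_iff_injective _).1 (Adjunction.mono_map_f_of_isZero_leftDerived_obj
    (shortExact_of_exact hf hfg hg) (ihom.adjunction (ModuleCat.of R M)) (h₃ 1 zero_lt_one))

lemma TorIndependent.of_linearEquiv (e : N₁ ≃ₗ[R] N₂) (h : TorIndependent R M N₁) :
    TorIndependent R M N₂ := fun i hi ↦
  (h i hi).of_iso (((Tor _ i).obj _).mapIso e.symm.toModuleIso)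

lemma TorIndependent.of_subsingleton [Subsingleton N₁] : TorIndependent R M N₁ := by
  rintro (_ | i) hi
  · exact absurd hi (lt_irrefl 0)
  · have := (ModuleCat.isZero_of_subsingleton (ModuleCat.of R N₁)).projective
    exact isZero_Tor_succ_of_projective _ _ _ i

lemma TorIndependent.pi_fin (h : TorIndependent R M N₁) (k : ℕ) :
    TorIndependent R M (Fin k → N₁) := by
  induction k with
  | zero => exact .of_subsingleton
  | succ k ih =>
    refine TorIndependent.of_linearEquiv (Fin.consLinearEquiv R fun _ ↦ N₁) ?_
    exact TorIndependent.of_exact (f := LinearMap.inl R _ _) (g := LinearMap.snd R _ _)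
      LinearMap.inl_injective .inl_snd LinearMap.snd_surjective h ih

end Tor

/-! ### Convergence in finitely generated modules. -/

section AdicCompletion

variable {R : Type*} [CommRing R]

/-- Adic completion preserves surjections and finite powers, so completeness descends along a
surjection `Rⁿ → M`. -/
lemma IsPrecomplete.of_finite (I : Ideal R) (M : Type*) [AddCommGroup M] [Module R M]
    [IsPrecomplete I R] [Module.Finite R M] : IsPrecomplete I M := by
  obtain ⟨n, f, hf⟩ := Module.Finite.exists_fin' R M
  rw [← AdicCompletion.of_surjective_iff]
  intro y
  obtain ⟨z, rfl⟩ := AdicCompletion.map_surjective I hf y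
  choose x hx using fun i ↦ AdicCompletion.of_surjective I R (AdicCompletion.piEquivFin I n z i)
  refine ⟨f x, ?_⟩
  rw [← AdicCompletion.map_of]
  congr 1
  apply (AdicCompletion.piEquivFin I n).injective
  ext1 i
  rw [← hx]
  simp [AdicCompletion.piEquivFin_apply]
  rfl

/-- Over a complete noetherian local ring, a sequence in a finitely generated module which is
Cauchy for the `I`-adic topology converges, for every proper ideal `I`. -/
lemma exists_forall_sub_mem_pow_smul_top [IsNoetherianRing R] [IsLocalRing R]
    [IsAdicComplete (IsLocalRing.maximalIdeal R) R] {M : Type*} [AddCommGroup M] [Module R M]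
    [Module.Finite R M] {I : Ideal R} (hI : I ≠ ⊤) (f : ℕ → M)
    (hf : ∀ n, f (n + 1) - f n ∈ (I ^ n • ⊤ : Submodule R M)) :
    ∃ L : M, ∀ n, L - f n ∈ (I ^ n • ⊤ : Submodule R M) := by
  have hle (n : ℕ) : (I ^ n • ⊤ : Submodule R M) ≤ IsLocalRing.maximalIdeal R ^ n • ⊤ :=
    Submodule.smul_mono_left (Ideal.pow_right_mono (IsLocalRing.le_maximalIdeal hI) n)
  have hf' {m n : ℕ} (h : m ≤ n) : f n - f m ∈ (I ^ m • ⊤ : Submodule R M) := by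
    induction n, h using Nat.le_induction with
    | base => simp
    | succ n h ih =>
      rw [← sub_add_sub_cancel]
      exact add_mem (Submodule.pow_smul_top_le I M h (hf n)) ih
  have := IsPrecomplete.of_finite (IsLocalRing.maximalIdeal R) M
  obtain ⟨L, hL⟩ := this.prec (f := f) fun {m n} h ↦
    (SModEq.sub_mem.2 (hle m (hf' h))).symm
  refine ⟨L, fun n ↦ ?_⟩
  -- The limit `L` is only known for the topology of the maximal ideal. The congruence modulo `Iⁿ`
  -- survives because `IⁿM` is closed there: `M/IⁿM` is Hausdorff.
  rw [← Submodule.Quotient.mk_eq_zero]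
  refine IsHausdorff.haus (I := IsLocalRing.maximalIdeal R) inferInstance _ fun k ↦ ?_
  rw [SModEq.zero]
  -- The term `f (max n k)` agrees with `f n` modulo `Iⁿ` and with `L` modulo the `k`-th power of
  -- the maximal ideal.
  have h1 : (Submodule.Quotient.mk (L - f n) : M ⧸ (I ^ n • ⊤ : Submodule R M)) =
      Submodule.mkQ _ (L - f (max n k)) := by
    refine (Submodule.Quotient.eq _).2 ?_
    rw [sub_sub_sub_cancel_left]
    exact hf' (le_max_left n k)
  rw [h1]
  have h2 : L - f (max n k) ∈ (IsLocalRing.maximalIdeal R ^ k • ⊤ : Submodule R M) :=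
    Submodule.pow_smul_top_le _ M (le_max_right n k) (SModEq.sub_mem.1 (hL _).symm)
  have h3 := Submodule.mem_map_of_mem (f := Submodule.mkQ (I ^ n • ⊤ : Submodule R M)) h2
  rw [Submodule.map_smul''] at h3
  exact Submodule.smul_mono le_rfl le_top h3

end AdicCompletion

/-! ### Normal flatness and the graded pieces `𝔞ⁿM/𝔞ⁿ⁺¹M`. -/

section NormallyFlat

variable {R : Type u} [CommRing R] {𝔞 : Ideal R}

/-- The map `𝔞ⁿ/𝔞ⁿ⁺¹ → R/𝔞ⁿ⁺¹`. -/
def Ideal.gradedPieceToQuotient (𝔞 : Ideal R) (n : ℕ) :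
    (↥(𝔞 ^ n) ⧸ (𝔞 • ⊤ : Submodule R ↥(𝔞 ^ n))) →ₗ[R] R ⧸ 𝔞 ^ (n + 1) :=
  Submodule.mapQ _ _ (Submodule.subtype (𝔞 ^ n)) (smul_top_pow_eq 𝔞 n).le

lemma Ideal.gradedPieceToQuotient_mk (n : ℕ) (x : ↥(𝔞 ^ n)) :
    𝔞.gradedPieceToQuotient n (Submodule.Quotient.mk x) =
      (x : R) • Ideal.Quotient.mk (𝔞 ^ (n + 1)) 1 := by
  rw [Algebra.smul_def, map_one, mul_one]
  rfl

lemma Ideal.gradedPieceToQuotient_injective (n : ℕ) :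
    Function.Injective (𝔞.gradedPieceToQuotient n) := by
  rw [injective_iff_map_eq_zero]
  intro x hx
  obtain ⟨x, rfl⟩ := Submodule.mkQ_surjective _ x
  replace hx := (Submodule.Quotient.mk_eq_zero _).1 hx
  exact (Submodule.Quotient.mk_eq_zero _).2 ((smul_top_pow_eq 𝔞 n).ge hx)

lemma Ideal.exact_gradedPieceToQuotient (n : ℕ) :
    Function.Exact (𝔞.gradedPieceToQuotient n)
      (Submodule.factor (Ideal.pow_le_pow_right (I := 𝔞) n.le_succ)) := by
  intro y
  obtain ⟨y, rfl⟩ := Submodule.mkQ_surjective _ y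
  constructor
  · intro h
    exact ⟨Submodule.Quotient.mk ⟨y, (Submodule.Quotient.mk_eq_zero _).1 h⟩, rfl⟩
  · rintro ⟨x, hx⟩
    obtain ⟨x, rfl⟩ := Submodule.mkQ_surjective _ x
    rw [← hx]
    exact (Submodule.Quotient.mk_eq_zero _).2 x.2

/-- `R/𝔞` is local because `𝔞` is proper, and a finitely generated flat module over a local ring is
free. -/
lemma IsNormallyFlat.exists_equiv_pi [IsNoetherianRing R] [IsLocalRing R] (h : IsNormallyFlat 𝔞)
    (h𝔞 : 𝔞 ≠ ⊤) {n : ℕ} (hn : 0 < n) :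
    ∃ k : ℕ, Nonempty ((↥(𝔞 ^ n) ⧸ (𝔞 • ⊤ : Submodule R ↥(𝔞 ^ n))) ≃ₗ[R] (Fin k → R ⧸ 𝔞)) := by
  have := h n hn
  have : Nontrivial (R ⧸ 𝔞) := Ideal.Quotient.nontrivial_iff.2 h𝔞
  have := IsLocalRing.of_surjective' (Ideal.Quotient.mk 𝔞) Ideal.Quotient.mk_surjective
  have : Module.Finite (R ⧸ 𝔞) (↥(𝔞 ^ n) ⧸ (𝔞 • ⊤ : Submodule R ↥(𝔞 ^ n))) :=
    Module.Finite.of_restrictScalars_finite R _ _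
  have := Module.free_of_flat_of_isLocalRing (R := R ⧸ 𝔞)
    (P := ↥(𝔞 ^ n) ⧸ (𝔞 • ⊤ : Submodule R ↥(𝔞 ^ n)))
  exact ⟨_, ⟨(Module.finBasis (R ⧸ 𝔞)
    (↥(𝔞 ^ n) ⧸ (𝔞 • ⊤ : Submodule R ↥(𝔞 ^ n)))).equivFun.restrictScalars R⟩⟩

variable {M : Type u} [AddCommGroup M] [Module R M]

theorem TorIndependent.quotient_pow [IsNoetherianRing R] [IsLocalRing R] (h𝔞 : 𝔞 ≠ ⊤)
    (hTor : TorIndependent R M (R ⧸ 𝔞)) (hflat : IsNormallyFlat 𝔞) (n : ℕ) :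
    TorIndependent R M (R ⧸ 𝔞 ^ n) := by
  induction n with
  | zero =>
    have : Subsingleton (R ⧸ 𝔞 ^ 0) := Ideal.Quotient.subsingleton_iff.2 (by simp)
    exact .of_subsingleton
  | succ n ih =>
    -- Normal flatness concerns positive exponents; the step from `𝔞⁰` to `𝔞¹` is the hypothesis on
    -- `R/𝔞`.
    obtain rfl | hn := n.eq_zero_or_pos
    · exact hTor.of_linearEquiv (Submodule.quotEquivOfEq _ _ (by simp))
    · obtain ⟨k, ⟨e⟩⟩ := hflat.exists_equiv_pi h𝔞 hn
      exact TorIndependent.of_exact (Ideal.gradedPieceToQuotient_injective n)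
        (Ideal.exact_gradedPieceToQuotient n) (Submodule.factor_surjective _)
        ((hTor.pi_fin k).of_linearEquiv e.symm) ih

lemma TorIndependent.lTensor_gradedPieceToQuotient_injective (n : ℕ)
    (h : TorIndependent R M (R ⧸ 𝔞 ^ n)) :
    Function.Injective ((𝔞.gradedPieceToQuotient n).lTensor M) :=
  TorIndependent.lTensor_injective (Ideal.gradedPieceToQuotient_injective n)
    (Ideal.exact_gradedPieceToQuotient n) (Submodule.factor_surjective _) h

lemma tmul_quotient_mk_one_eq_zero_iff (I : Ideal R) (m : M) :
    m ⊗ₜ[R] (Ideal.Quotient.mk I 1) = 0 ↔ m ∈ (I • ⊤ : Submodule R M) := by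
  rw [← (TensorProduct.tensorQuotEquivQuotSMul M I).map_eq_zero_iff,
    TensorProduct.tensorQuotEquivQuotSMul_tmul_mk, one_smul, Submodule.Quotient.mk_eq_zero]

/-- Project to the `j`-th coordinate and identify `M ⊗ R/I` with `M/IM`. -/
lemma mem_smul_top_of_sum_tmul_eq_zero {N : Type*} [AddCommGroup N] [Module R N] {I : Ideal R}
    {k : ℕ} (e : N ≃ₗ[R] (Fin k → R ⧸ I)) {l : Fin k → M}
    (h : ∑ j, l j ⊗ₜ[R] e.symm (Pi.single j 1) = 0) (j : Fin k) :
    l j ∈ (I • ⊤ : Submodule R M) := by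
  have h1 := congrArg (((LinearMap.proj j).comp e.toLinearMap).lTensor M) h
  rw [map_sum, map_zero, Finset.sum_eq_single j] at h1
  · rw [← tmul_quotient_mk_one_eq_zero_iff, ← h1]
    simp
  · intro i _ hij
    simp [hij.symm]
  · simp

/-- If `R` is normally flat along `𝔞` and `M` and `R/𝔞` are `Tor`-independent, there are elements
of `𝔞ⁿ` which are a basis of `𝔞ⁿM/𝔞ⁿ⁺¹M` with coefficients in `M/𝔞M`. -/
lemma IsNormallyFlat.exists_basis [IsNoetherianRing R] [IsLocalRing R] (hflat : IsNormallyFlat 𝔞)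
    (h𝔞 : 𝔞 ≠ ⊤) (hTor : TorIndependent R M (R ⧸ 𝔞)) {n : ℕ} (hn : 0 < n) :
    ∃ (k : ℕ) (x : Fin k → R), (∀ j, x j ∈ 𝔞 ^ n) ∧
      (∀ m ∈ (𝔞 ^ n • ⊤ : Submodule R M), ∃ l : Fin k → M,
        m - ∑ j, x j • l j ∈ (𝔞 ^ (n + 1) • ⊤ : Submodule R M)) ∧
      ∀ l : Fin k → M, ∑ j, x j • l j ∈ (𝔞 ^ (n + 1) • ⊤ : Submodule R M) →
        ∀ j, l j ∈ (𝔞 • ⊤ : Submodule R M) := by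
  obtain ⟨k, ⟨e⟩⟩ := hflat.exists_equiv_pi h𝔞 hn
  choose x hx using fun j ↦ Submodule.mkQ_surjective _ (e.symm (Pi.single j 1))
  refine ⟨k, fun j ↦ (x j).1, fun j ↦ (x j).2, fun m hm ↦ ?_, fun l hl ↦ ?_⟩
  · refine Submodule.smul_induction_on hm (fun r hr m _ ↦ ?_) fun m m' h h' ↦ ?_
    · choose c hc using fun j ↦
        Ideal.Quotient.mk_surjective (e (Submodule.Quotient.mk ⟨r, hr⟩) j)
      refine ⟨fun j ↦ c j • m, ?_⟩
      -- The `c j` lift the coordinates of the class of `r`, so `r ≡ ∑ c j * x j` modulo `𝔞ⁿ⁺¹`.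
      have key : (⟨r, hr⟩ - ∑ j, c j • x j : ↥(𝔞 ^ n)) ∈ (𝔞 • ⊤ : Submodule R ↥(𝔞 ^ n)) := by
        rw [← Submodule.Quotient.mk_eq_zero]
        apply e.injective
        rw [map_zero, ← Submodule.mkQ_apply, map_sub, map_sum, map_sub, map_sum]
        ext i
        simp only [map_smul, hx, LinearEquiv.apply_symm_apply]
        simp [Finset.sum_apply, Pi.single_apply, ← hc, Algebra.smul_def]
      rw [smul_top_pow_eq] at key
      have h2 : r • m - ∑ j, (x j).1 • c j • m = (r - ∑ j, c j * (x j).1) • m := by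
        simp [sub_smul, Finset.sum_smul, mul_smul, smul_comm (c _)]
      rw [h2]
      exact Submodule.smul_mem_smul (by simpa using key) trivial
    · obtain ⟨l, hl⟩ := h
      obtain ⟨l', hl'⟩ := h'
      refine ⟨l + l', ?_⟩
      convert add_mem hl hl' using 1
      simp only [Pi.add_apply, smul_add, Finset.sum_add_distrib]
      abel
  · refine mem_smul_top_of_sum_tmul_eq_zero e ?_
    -- The relation holds in `M/𝔞ⁿ⁺¹M = M ⊗ R/𝔞ⁿ⁺¹`; injectivity brings it back to `M ⊗ 𝔞ⁿ/𝔞ⁿ⁺¹`.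
    apply TorIndependent.lTensor_gradedPieceToQuotient_injective n
      (hTor.quotient_pow h𝔞 hflat n)
    rw [map_sum, map_zero]
    rw [← tmul_quotient_mk_one_eq_zero_iff, TensorProduct.sum_tmul] at hl
    rw [← hl]
    refine Finset.sum_congr rfl fun j _ ↦ ?_
    rw [LinearMap.lTensor_tmul, ← hx, TensorProduct.smul_tmul, Submodule.mkQ_apply,
      Ideal.gradedPieceToQuotient_mk]

end NormallyFlat

/-! ### Matrices over `Λ` with the `𝔞`-adic filtration. -/

section

variable {R Λ : Type u} [CommRing R] [Ring Λ] [Algebra R Λ] (𝔞 : Ideal R)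

lemma mul_mem_pow_add_smul_top {a b : ℕ} {x y : Λ} (hx : x ∈ (𝔞 ^ a • ⊤ : Submodule R Λ))
    (hy : y ∈ (𝔞 ^ b • ⊤ : Submodule R Λ)) : x * y ∈ (𝔞 ^ (a + b) • ⊤ : Submodule R Λ) := by
  refine Submodule.smul_induction_on hx (fun r hr z _ ↦ ?_) fun z z' h h' ↦ ?_
  · refine Submodule.smul_induction_on hy (fun s hs w _ ↦ ?_) fun w w' h h' ↦ ?_
    · rw [smul_mul_smul_comm, pow_add]
      exact Submodule.smul_mem_smul (Ideal.mul_mem_mul hr hs) trivial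
    · rw [mul_add]
      exact add_mem h h'
  · rw [add_mul]
    exact add_mem h h'

/-- The submodule of matrices with entries in `𝔞ᵏΛ`. -/
def Matrix.adicSubmodule (m n : Type) (k : ℕ) : Submodule R (Matrix m n Λ) where
  carrier := {A | ∀ i j, A i j ∈ (𝔞 ^ k • ⊤ : Submodule R Λ)}
  add_mem' h h' i j := add_mem (h i j) (h' i j)
  zero_mem' _ _ := zero_mem _
  smul_mem' r _ h i j := Submodule.smul_mem _ r (h i j)

namespace Matrix

variable {𝔞} {l m n : Type}

lemma mem_adicSubmodule {k : ℕ} {A : Matrix m n Λ} :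
    A ∈ adicSubmodule 𝔞 m n k ↔ ∀ i j, A i j ∈ (𝔞 ^ k • ⊤ : Submodule R Λ) := Iff.rfl

lemma adicSubmodule_anti {a b : ℕ} (h : a ≤ b) :
    (adicSubmodule 𝔞 m n b : Submodule R (Matrix m n Λ)) ≤ adicSubmodule 𝔞 m n a :=
  fun _ hA i j ↦ Submodule.pow_smul_top_le 𝔞 Λ h (hA i j)

lemma mul_mem_adicSubmodule [Fintype m] {a b : ℕ} {A : Matrix l m Λ} {B : Matrix m n Λ}
    (hA : A ∈ adicSubmodule 𝔞 l m a) (hB : B ∈ adicSubmodule 𝔞 m n b) :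
    A * B ∈ adicSubmodule 𝔞 l n (a + b) := fun i j ↦ by
  rw [mul_apply]
  exact sum_mem fun c _ ↦ mul_mem_pow_add_smul_top 𝔞 (hA i c) (hB c j)

lemma mem_adicSubmodule_zero (A : Matrix m n Λ) : A ∈ adicSubmodule 𝔞 m n 0 := fun i j ↦ by
  simp

lemma mul_mem_adicSubmodule_left [Fintype m] {k : ℕ} (A : Matrix l m Λ) {B : Matrix m n Λ}
    (hB : B ∈ adicSubmodule 𝔞 m n k) : A * B ∈ adicSubmodule 𝔞 l n k := by
  simpa using mul_mem_adicSubmodule (mem_adicSubmodule_zero A) hB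

lemma mul_mem_adicSubmodule_right [Fintype m] {k : ℕ} {A : Matrix l m Λ} (B : Matrix m n Λ)
    (hA : A ∈ adicSubmodule 𝔞 l m k) : A * B ∈ adicSubmodule 𝔞 l n k := by
  simpa using mul_mem_adicSubmodule hA (mem_adicSubmodule_zero B)

lemma mul_sub_mul_mem_adicSubmodule [Fintype m] {k : ℕ} {A A' : Matrix l m Λ} {B B' : Matrix m n Λ}
    (hA : A - A' ∈ adicSubmodule 𝔞 l m k) (hB : B - B' ∈ adicSubmodule 𝔞 m n k) :
    A * B - A' * B' ∈ adicSubmodule 𝔞 l n k := by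
  have : A * B - A' * B' = (A - A') * B + A' * (B - B') := by
    rw [Matrix.sub_mul, Matrix.mul_sub]; abel
  rw [this]
  exact add_mem (mul_mem_adicSubmodule_right _ hA) (mul_mem_adicSubmodule_left _ hB)

lemma smul_mem_adicSubmodule {a b : ℕ} {r : R} (hr : r ∈ 𝔞 ^ a) {A : Matrix m n Λ}
    (hA : A ∈ adicSubmodule 𝔞 m n b) : r • A ∈ adicSubmodule 𝔞 m n (a + b) := fun i j ↦ by
  rw [pow_add, ← smul_eq_mul, Submodule.smul_assoc]
  exact Submodule.smul_mem_smul hr (hA i j)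

lemma eq_zero_of_forall_mem_adicSubmodule [IsNoetherianRing R] [IsLocalRing R] [Module.Finite R Λ]
    (h𝔞 : 𝔞 ≠ ⊤) {A : Matrix m n Λ} (h : ∀ k, A ∈ adicSubmodule 𝔞 m n k) : A = 0 := by
  ext i j
  have := IsHausdorff.of_isLocalRing 𝔞 Λ h𝔞
  exact this.haus _ fun k ↦ SModEq.zero.2 (h k i j)

lemma exists_forall_sub_mem_adicSubmodule [IsNoetherianRing R] [IsLocalRing R]
    [IsAdicComplete (IsLocalRing.maximalIdeal R) R] [Module.Finite R Λ]
    (h𝔞 : 𝔞 ≠ ⊤) (A : ℕ → Matrix m n Λ) (hA : ∀ k, A (k + 1) - A k ∈ adicSubmodule 𝔞 m n k) :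
    ∃ B : Matrix m n Λ, ∀ k, B - A k ∈ adicSubmodule 𝔞 m n k := by
  choose B hB using fun i j ↦ exists_forall_sub_mem_pow_smul_top h𝔞 (fun k ↦ A k i j)
    fun k ↦ hA k i j
  exact ⟨B, fun k i j ↦ hB i j k⟩

variable (Λ) in
/-- The elements `x j` of `𝔞ᵏ` are a basis of `𝔞ᵏΛ/𝔞ᵏ⁺¹Λ` with coefficients in `Λ/𝔞Λ`. -/
structure IsAdicBasis (𝔞 : Ideal R) (k : ℕ) {c : ℕ} (x : Fin c → R) : Prop where
  mem : ∀ j, x j ∈ 𝔞 ^ k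
  span : ∀ m ∈ (𝔞 ^ k • ⊤ : Submodule R Λ), ∃ l : Fin c → Λ,
        m - ∑ j, x j • l j ∈ (𝔞 ^ (k + 1) • ⊤ : Submodule R Λ)
  indep : ∀ l : Fin c → Λ, ∑ j, x j • l j ∈ (𝔞 ^ (k + 1) • ⊤ : Submodule R Λ) →
        ∀ j, l j ∈ (𝔞 • ⊤ : Submodule R Λ)

namespace IsAdicBasis

variable {k c : ℕ} {x : Fin c → R} (hx : IsAdicBasis Λ 𝔞 k x)

include hx

lemma exists_sub_sum_mem {A : Matrix m n Λ} (hA : A ∈ adicSubmodule 𝔞 m n k) :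
    ∃ f : Fin c → Matrix m n Λ, A - ∑ j, x j • f j ∈ adicSubmodule 𝔞 m n (k + 1) := by
  choose f hf using fun i j ↦ hx.span _ (hA i j)
  exact ⟨fun a ↦ Matrix.of fun i j ↦ f i j a, fun i j ↦ by simpa [Matrix.sum_apply] using hf i j⟩

lemma mem_of_sum_mem {f : Fin c → Matrix m n Λ}
    (hf : ∑ j, x j • f j ∈ adicSubmodule 𝔞 m n (k + 1)) (j : Fin c) :
    f j ∈ adicSubmodule 𝔞 m n 1 := fun a b ↦ by
  rw [pow_one]
  exact hx.indep (fun j ↦ f j a b) (by simpa [Matrix.sum_apply] using hf a b) j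

end IsAdicBasis

end Matrix

open Matrix

/-! ### Lifting a complex of matrices step by step. -/

section Deformation

variable {𝔞} {n : ℤ → ℕ}

/-- The sequence `d` of matrices over `Λ` is a complex modulo `𝔞Λ`, and every morphism of degree two
from this complex to itself is homotopic to zero. -/
structure IsUnobstructed (𝔞 : Ideal R) (d : ∀ i : ℤ, Matrix (Fin (n (i + 1))) (Fin (n i)) Λ) :
    Prop where
  mul_mem : ∀ i, d (i + 1) * d i ∈ adicSubmodule 𝔞 _ _ 1
  exists_homotopy : ∀ f : ∀ i : ℤ, Matrix (Fin (n (i + 1 + 1))) (Fin (n i)) Λ,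
    (∀ i, d (i + 1 + 1) * f i - f (i + 1) * d i ∈ adicSubmodule 𝔞 _ _ 1) →
    ∃ h : ∀ i : ℤ, Matrix (Fin (n (i + 1))) (Fin (n i)) Λ,
      ∀ i, f i - (d (i + 1) * h i + h (i + 1) * d i) ∈ adicSubmodule 𝔞 _ _ 1

namespace IsUnobstructed

variable {d : ∀ i : ℤ, Matrix (Fin (n (i + 1))) (Fin (n i)) Λ}

/-- The condition depends only on `d` modulo `𝔞Λ`, so it persists through all corrections. -/
lemma congr (hd : IsUnobstructed 𝔞 d) {d' : ∀ i : ℤ, Matrix (Fin (n (i + 1))) (Fin (n i)) Λ}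
    (h : ∀ i, d' i - d i ∈ adicSubmodule 𝔞 _ _ 1) : IsUnobstructed 𝔞 d' where
  mul_mem i := by
    rw [← sub_add_cancel (d' (i + 1) * d' i) (d (i + 1) * d i)]
    exact add_mem (mul_sub_mul_mem_adicSubmodule (h _) (h _)) (hd.mul_mem i)
  exists_homotopy f hf := by
    obtain ⟨g, hg⟩ := hd.exists_homotopy f fun i ↦ by
      have h1 := mul_sub_mul_mem_adicSubmodule (h (i + 1 + 1)) (B := f i) (B' := f i) (by simp)
      have h2 := mul_sub_mul_mem_adicSubmodule (A := f (i + 1)) (A' := f (i + 1)) (by simp) (h i)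
      convert add_mem (sub_mem (hf i) h1) h2 using 1
      abel
    refine ⟨g, fun i ↦ ?_⟩
    have h1 := mul_sub_mul_mem_adicSubmodule (h (i + 1)) (B := g i) (B' := g i) (by simp)
    have h2 := mul_sub_mul_mem_adicSubmodule (A := g (i + 1)) (A' := g (i + 1)) (by simp) (h i)
    convert sub_mem (sub_mem (hg i) h1) h2 using 1
    abel

/-- If `d` is unobstructed, and a complex modulo `𝔞ᵏΛ`, then it can be changed modulo `𝔞ᵏΛ` to a
complex modulo `𝔞ᵏ⁺¹Λ`. -/
lemma exists_sub_mem_of_mul_mem (hd : IsUnobstructed 𝔞 d) {k c : ℕ} (hk : 0 < k) {x : Fin c → R}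
    (hx : IsAdicBasis Λ 𝔞 k x) (hdk : ∀ i, d (i + 1) * d i ∈ adicSubmodule 𝔞 _ _ k) :
    ∃ d' : ∀ i : ℤ, Matrix (Fin (n (i + 1))) (Fin (n i)) Λ,
      (∀ i, d' i - d i ∈ adicSubmodule 𝔞 _ _ k) ∧
      ∀ i, d' (i + 1) * d' i ∈ adicSubmodule 𝔞 _ _ (k + 1) := by
  choose f hf using fun i ↦ hx.exists_sub_sum_mem (hdk i)
  have hdf (i : ℤ) (j : Fin c) :
      d (i + 1 + 1) * f i j - f (i + 1) j * d i ∈ adicSubmodule 𝔞 _ _ 1 := by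
    refine hx.mem_of_sum_mem (f := fun j ↦ d (i + 1 + 1) * f i j - f (i + 1) j * d i) ?_ j
    -- Both `d · ∑ x j • f j` and `(∑ x j • f j) · d` approximate the triple product `d · d · d`,
    -- which cancels in the difference.
    have h1 := mul_mem_adicSubmodule_left (d (i + 1 + 1)) (hf i)
    have h2 := mul_mem_adicSubmodule_right (d i) (hf (i + 1))
    convert sub_mem h2 h1 using 1
    simp only [Matrix.sub_mul, Matrix.mul_sub, Matrix.mul_sum, Matrix.sum_mul, Matrix.mul_assoc,
      smul_sub, Matrix.mul_smul, Matrix.smul_mul, Finset.sum_sub_distrib]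
    abel
  choose h hh using fun j ↦ hd.exists_homotopy (fun i ↦ f i j) fun i ↦ hdf i j
  have hmem (i : ℤ) : ∑ j, x j • h j i ∈ adicSubmodule 𝔞 _ _ k :=
    sum_mem fun j _ ↦ by
      simpa using smul_mem_adicSubmodule (hx.mem j) (mem_adicSubmodule_zero (h j i))
  refine ⟨fun i ↦ d i - ∑ j, x j • h j i, fun i ↦ by simpa using hmem i, fun i ↦ ?_⟩
  have h1 : ∑ j, x j • (f i j - (d (i + 1) * h j i + h j (i + 1) * d i)) ∈
      adicSubmodule 𝔞 _ _ (k + 1) :=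
    sum_mem fun j _ ↦ smul_mem_adicSubmodule (hx.mem j) (hh j i)
  -- The quadratic term in the correction lies in `𝔞²ᵏ`, which is small enough because `k > 0`.
  have h2 := adicSubmodule_anti (show k + 1 ≤ k + k by lia)
    (mul_mem_adicSubmodule (hmem (i + 1)) (hmem i))
  -- With `H = ∑ x j • h j`, the new square is `(d² - ∑ x j • f j) + ∑ x j • (f j - d h j - h j d) +
  -- H²`.
  convert add_mem (add_mem (hf i) h1) h2 using 1
  simp only [Matrix.sub_mul, Matrix.mul_sub, Matrix.mul_sum, Matrix.sum_mul,
    smul_sub, smul_add, Matrix.mul_smul, Matrix.smul_mul, Finset.sum_sub_distrib,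
    Finset.sum_add_distrib]
  abel

/-- An unobstructed complex modulo `𝔞Λ` lifts to a complex over `Λ`. -/
theorem exists_lift [IsNoetherianRing R] [IsLocalRing R]
    [IsAdicComplete (IsLocalRing.maximalIdeal R) R] [Module.Finite R Λ] (h𝔞 : 𝔞 ≠ ⊤)
    (hx : ∀ k : ℕ, 0 < k → ∃ (c : ℕ) (x : Fin c → R), IsAdicBasis Λ 𝔞 k x)
    (hd : IsUnobstructed 𝔞 d) :
    ∃ d' : ∀ i : ℤ, Matrix (Fin (n (i + 1))) (Fin (n i)) Λ,
      (∀ i, d' i - d i ∈ adicSubmodule 𝔞 _ _ 1) ∧ ∀ i, d' (i + 1) * d' i = 0 := by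
  -- Stage `k` is a complex modulo `𝔞ᵏ⁺¹`, so that the given `d` is stage `0`.
  let T (k : ℕ) := { d' : ∀ i : ℤ, Matrix (Fin (n (i + 1))) (Fin (n i)) Λ //
    IsUnobstructed 𝔞 d' ∧ ∀ i, d' (i + 1) * d' i ∈ adicSubmodule 𝔞 _ _ (k + 1) }
  have step (k : ℕ) (t : T k) : ∃ t' : T (k + 1),
      ∀ i, t'.1 i - t.1 i ∈ adicSubmodule 𝔞 _ _ (k + 1) := by
    obtain ⟨c, x, hx⟩ := hx (k + 1) k.succ_pos
    obtain ⟨d', h, h'⟩ := t.2.1.exists_sub_mem_of_mul_mem k.succ_pos hx t.2.2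
    exact ⟨⟨d', t.2.1.congr fun i ↦ adicSubmodule_anti (by lia) (h i), h'⟩, h⟩
  choose next hnext using step
  let s : ∀ k, T k := fun k ↦ Nat.rec ⟨d, hd, hd.mul_mem⟩ next k
  choose B hB using fun i ↦ exists_forall_sub_mem_adicSubmodule h𝔞 (fun k ↦ (s k).1 i)
    fun k ↦ adicSubmodule_anti k.le_succ (hnext k (s k) i)
  refine ⟨B, fun i ↦ ?_, fun i ↦ eq_zero_of_forall_mem_adicSubmodule h𝔞 fun k ↦ ?_⟩
  -- The limit agrees with stage `k` only modulo `𝔞ᵏ`, so the comparison with `d` goes through stage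
  -- `1`.
  · rw [← sub_add_sub_cancel _ ((s 1).1 i)]
    exact add_mem (hB i 1) (hnext 0 (s 0) i)
  · rw [← sub_add_cancel (B (i + 1) * B i) ((s k).1 (i + 1) * (s k).1 i)]
    exact add_mem (mul_sub_mul_mem_adicSubmodule (hB _ k) (hB _ k))
      (adicSubmodule_anti k.le_succ ((s k).2.2 i))

end IsUnobstructed

end Deformation

end

/-! ### Replacing complexes of projectives by complexes of free modules. -/

namespace CochainComplex

open HomComplex

section Swindle

variable {C : Type u₁} [Category.{v₁} C] [Preadditive C] [HasBinaryBiproducts C]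
  (K : CochainComplex C ℤ) {Q F : ℤ → C} (e : ∀ i, (K.X i ⊞ Q (i + 1)) ⊞ Q i ≅ F i)

/-- The differential of the direct sum of a complex `K` and of the contractible complexes
`Q i ⟶ Q i` in degrees `i - 1` and `i`. -/
noncomputable def swindleD (i : ℤ) : F i ⟶ F (i + 1) :=
  (e i).inv ≫ (biprod.fst ≫ biprod.fst ≫ K.d i (i + 1) ≫ biprod.inl ≫ biprod.inl +
    biprod.fst ≫ biprod.snd ≫ biprod.inr) ≫ (e (i + 1)).hom

/-- The direct sum of a complex `K` and of the contractible complexes `Q i ⟶ Q i` in degrees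
`i - 1` and `i`. -/
noncomputable abbrev swindle : CochainComplex C ℤ :=
  CochainComplex.of F (K.swindleD e) (fun i ↦ by simp [swindleD])

/-- The inclusion of `K` in the direct sum. -/
noncomputable def toSwindle : K ⟶ K.swindle e where
  f i := biprod.inl ≫ biprod.inl ≫ (e i).hom
  comm' i j := by
    rintro rfl
    simp [swindleD]

/-- The projection to `K` from the direct sum. -/
noncomputable def fromSwindle : K.swindle e ⟶ K where
  f i := (e i).inv ≫ biprod.fst ≫ biprod.fst
  comm' i j := by
    rintro rfl
    simp [swindleD]

/-- The complexes `K` and `K.swindle e` are homotopy equivalent. -/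
noncomputable def swindleHomotopyEquiv : HomotopyEquiv K (K.swindle e) where
  hom := K.toSwindle e
  inv := K.fromSwindle e
  homotopyHomInvId := Homotopy.ofEq (by ext i; simp [toSwindle, fromSwindle])
  homotopyInvHomId := Homotopy.symm <| (Cochain.equivHomotopy _ _).symm
    -- The contraction sends the summand `Q p` in degree `p` identically to the summand `Q p` in
    -- degree `p - 1`.
    ⟨Cochain.mk fun p q hpq ↦ (e p).inv ≫ biprod.snd ≫
      eqToHom (by rw [← hpq, neg_add_cancel_right]) ≫ biprod.inr ≫ biprod.inl ≫ (e q).hom, by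
      ext p
      obtain ⟨q, rfl⟩ : ∃ q, p = q + 1 := ⟨p - 1, by simp⟩
      rw [Cochain.add_v, δ_v (-1) 0 (by simp) _ (q + 1) (q + 1) (by simp) q (q + 1 + 1) (by simp)
        rfl, ← cancel_epi (e (q + 1)).hom, ← cancel_mono (e (q + 1)).inv]
      ext <;> simp [toSwindle, fromSwindle, swindleD]⟩

end Swindle

section

variable {C : Type u₁} [Category.{v₁} C] [Abelian C] {free : ℕ → C}

/-- An epimorphism from a free object to a projective splits, and its kernel is the complement. -/
lemma exists_biprod_iso_free (hproj : ∀ n, Projective (free n))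
    (hepi : ∀ X, ∃ (n : ℕ) (p : free n ⟶ X), Epi p) (X : C) (hX : Projective X) :
    ∃ Y : C, Projective Y ∧ ∃ n, Nonempty (X ⊞ Y ≅ free n) := by
  obtain ⟨n, p, _⟩ := hepi X
  let S := ShortComplex.mk (kernel.ι p) p (by simp)
  have hS : S.Exact := ShortComplex.exact_of_f_is_kernel _ (kernelIsKernel p)
  let s : S.Splitting := ShortComplex.Splitting.ofExactOfSection S hS (Projective.factorThru (𝟙 X) p)
    (Projective.factorThru_comp _ _) (inferInstanceAs (Mono (kernel.ι p)))
  have := hproj n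
  refine ⟨kernel p, ?_, n, ⟨biprod.braiding _ _ ≪≫ s.isoBinaryBiproduct.symm⟩⟩
  exact Retract.projective (Y := free n) ⟨kernel.ι p, s.r, s.f_r⟩

/-- A bounded above complex of projectives is homotopy equivalent to a bounded above complex of
objects of the form `free n`, if every object is a quotient of such an object. -/
lemma exists_homotopyEquiv_free (hproj : ∀ n, Projective (free n))
    (hepi : ∀ X, ∃ (n : ℕ) (p : free n ⟶ X), Epi p) (hzero : IsZero (free 0))
    (K : CochainComplex C ℤ) (hK : ∀ i, Projective (K.X i)) (N : ℤ) [K.IsStrictlyLE N] :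
    ∃ (n : ℤ → ℕ) (d : ∀ i, free (n i) ⟶ free (n (i + 1))) (sq : ∀ i, d i ≫ d (i + 1) = 0),
      (∀ i, N < i → n i = 0) ∧ Nonempty (HomotopyEquiv K (CochainComplex.of _ d sq)) := by
  choose compl hcompl m e using exists_biprod_iso_free hproj hepi
  -- Going down from degree `N`, `Q (k + 1)` is a complement of `K.X (N - k) ⊞ Q k` in a free
  -- object, so adding it in degree `N - k` makes that degree free.
  let Q : ℕ → { X : C // Projective X } := fun k ↦ Nat.rec ⟨free 0, hproj 0⟩
    (fun k X ↦ ⟨compl (K.X (N - k) ⊞ X.1)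
      (by have := X.2; have := hK (N - k); infer_instance), hcompl _ _⟩) k
  -- For `i > N` the truncation by `toNat` gives `Q 0`, which is zero.
  let Q' (i : ℤ) : C := (Q (N + 1 - i).toNat).1
  have key (i : ℤ) : ∃ n : ℕ, (N < i → n = 0) ∧
      Nonempty ((K.X i ⊞ Q' (i + 1)) ⊞ Q' i ≅ free n) := by
    by_cases hi : N < i
    · have h (j : ℤ) (hj : N < j) : IsZero (Q' j) := by
        have : (N + 1 - j).toNat = 0 := by lia
        simp only [Q', this]
        exact hzero
      have h0 : IsZero (K.X i) := K.isZero_of_isStrictlyLE N i hi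
      exact ⟨0, fun _ ↦ rfl, ⟨IsZero.iso ((biprod_isZero_iff _ _).2
        ⟨(biprod_isZero_iff _ _).2 ⟨h0, h _ (by lia)⟩, h _ hi⟩) hzero⟩⟩
    · obtain ⟨k, rfl⟩ : ∃ k : ℕ, i = N - k := ⟨(N - i).toNat, by lia⟩
      have h1 : (N + 1 - (N - k)).toNat = k + 1 := by lia
      have h2 : (N + 1 - (N - k + 1)).toNat = k := by lia
      simp only [Q', h1, h2]
      exact ⟨_, fun h ↦ absurd h hi, e (K.X (N - k) ⊞ (Q k).1) _⟩
  choose n hn e' using key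
  exact ⟨n, _, _, hn, ⟨K.swindleHomotopyEquiv fun i ↦ (e' i).some⟩⟩

end

/-- If `K` is K-projective and there are no nonzero morphisms from `K` to `K⟦n⟧` in the derived
category, then every cocycle of degree `n` is a coboundary. -/
lemma exists_δ_eq_of_forall_eq_zero {C : Type u₁} [Category.{v₁} C] [Abelian C]
    [HasDerivedCategory.{w₁} C] (K : CochainComplex C ℤ) [K.IsKProjective] (n m : ℤ)
    (hmn : m + 1 = n)
    (h : ∀ g : DerivedCategory.Q.obj K ⟶ (DerivedCategory.Q.obj K)⟦n⟧, g = 0)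
    (z : Cocycle K K n) : ∃ w : Cochain K K m, δ m n w = z := by
  rw [← mem_coboundaries_iff _ m hmn, ← CohomologyClass.toHom_mk_eq_zero_iff]
  apply (CochainComplex.IsKProjective.Qh_map_bijective _ _).1
  have := h (DerivedCategory.Q.map (Cocycle.equivHomShift.symm z) ≫
    (DerivedCategory.Q.commShiftIso n).hom.app K)
  rw [Preadditive.IsIso.comp_right_eq_zero] at this
  rw [CohomologyClass.toHom_mk, Functor.map_zero,
    ← cancel_mono ((DerivedCategory.quotientCompQhIso C).hom.app _),
    DerivedCategory.quotientCompQhIso_hom_naturality, this]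
  simp

end CochainComplex

namespace DerivedCategory.Minus

variable {C : Type u₁} [Category.{v₁} C] [Abelian C] [HasDerivedCategory.{w₁} C]
  [EnoughProjectives C] {free : ℕ → C}

lemma exists_free (hproj : ∀ n, Projective (free n))
    (hepi : ∀ X, ∃ (n : ℕ) (p : free n ⟶ X), Epi p) (hzero : IsZero (free 0))
    (X : DerivedCategory.Minus C) :
    ∃ (n : ℤ → ℕ) (d : ∀ i, free (n i) ⟶ free (n (i + 1))) (sq : ∀ i, d i ≫ d (i + 1) = 0)
      (N : ℤ), (∀ i, N < i → n i = 0) ∧ Nonempty (Q.obj (CochainComplex.of _ d sq) ≅ X.obj) := by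
  obtain ⟨P, hP, ⟨e⟩⟩ := exists_projective X
  obtain ⟨N, hN⟩ := P.property
  obtain ⟨n, d, sq, hn, ⟨f⟩⟩ :=
    CochainComplex.exists_homotopyEquiv_free hproj hepi hzero P.obj.as hP N
  exact ⟨n, d, sq, N, hn, ⟨(quotientCompQhIso C).symm.app _ ≪≫
    DerivedCategory.Qh.mapIso (HomotopyCategory.isoOfHomotopyEquiv f).symm ≪≫ ι.mapIso e⟩⟩

end DerivedCategory.Minus

namespace CategoryTheory.Functor

variable {C : Type u₁} [Category.{v₁} C] [Abelian C] [HasDerivedCategory.{w₁} C]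
  {D : Type u₂} [Category.{v₂} D] [Abelian D] [HasDerivedCategory.{w₂} D]
  (F : C ⥤ D) [F.Additive]

/-- On a bounded above complex of projectives the counit of the Kan extension is invertible, so the
derived functor is `F` applied degreewise. -/
lemma exists_leftDerivedFunctorMinus_obj_iso [EnoughProjectives C] (L : CochainComplex C ℤ)
    (hL : ∀ i, Projective (L.X i)) (N : ℤ) [L.IsStrictlyLE N] (X : DerivedCategory.Minus D)
    (e : DerivedCategory.Q.obj ((F.mapHomologicalComplex _).obj L) ≅ X.obj) :
    ∃ Y : DerivedCategory.Minus C, Nonempty (F.leftDerivedFunctorMinus.obj Y ≅ X) := by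
  let P : HomotopyCategory.Minus C := ⟨(HomotopyCategory.quotient _ _).obj L, N, ‹L.IsStrictlyLE N›⟩
  have := DerivedCategory.Minus.isIso_rightKanExtensionCounit_app
    (F.mapHomotopyCategoryMinus ⋙ DerivedCategory.Minus.Qh) P hL
  let e' : DerivedCategory.Minus.Qh.obj (F.mapHomotopyCategoryMinus.obj P) ≅ X :=
    DerivedCategory.Minus.ι.preimageIso ((DerivedCategory.quotientCompQhIso D).app
      ((F.mapHomologicalComplex _).obj L) ≪≫ e)
  exact ⟨DerivedCategory.Minus.Qh.obj P, ⟨@asIso _ _ _ _ _ this ≪≫ e'⟩⟩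

end CategoryTheory.Functor

/-! ### Finite free right modules, matrices and extension of scalars. -/

section ExtendScalars

variable {A B : Type u} [Ring A] [Ring B] (f : A →+* B) (n : ℕ)

/-- The canonical map `Aⁿ ⊗_A B → Bⁿ`. -/
def extendScalarsPiHom : ExtendScalars f (Fin n → A) →ₗ[Bᵐᵒᵖ] (Fin n → B) :=
  Submodule.liftQ _ (TensorProduct.AlgebraTensorModule.lift
    { toFun b := AddMonoidHom.toIntLinearMap
        { toFun m i := f (m i) * b
          map_zero' := by ext; simp
          map_add' m m' := by ext; simp [add_mul] }
      map_add' b b' := by ext; simp [mul_add]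
      map_smul' c b := by ext; simp [mul_assoc] }) (by
    rw [extendScalarsRel, Submodule.span_le]
    rintro _ ⟨a, b, m, rfl⟩
    ext
    simp [mul_assoc])

lemma extendScalarsPiHom_mk_tmul (b : B) (m : Fin n → A) (i : Fin n) :
    extendScalarsPiHom f n (Submodule.Quotient.mk (b ⊗ₜ[ℤ] m)) i = f (m i) * b := rfl

lemma extendScalars_mk_smul_tmul {M : Type u} [AddCommGroup M] [Module Aᵐᵒᵖ M] (a : A) (b : B)
    (m : M) : (Submodule.Quotient.mk ((f a * b) ⊗ₜ[ℤ] m) : ExtendScalars f M) =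
      Submodule.Quotient.mk (b ⊗ₜ[ℤ] (MulOpposite.op a • m)) :=
  (Submodule.Quotient.eq _).2 (Submodule.subset_span ⟨a, b, m, rfl⟩)

/-- The canonical isomorphism `Aⁿ ⊗_A B ≃ Bⁿ`. -/
def extendScalarsPiEquiv : ExtendScalars f (Fin n → A) ≃ₗ[Bᵐᵒᵖ] (Fin n → B) :=
  LinearEquiv.ofLinearMap (extendScalarsPiHom f n)
    { toFun v := ∑ i, Submodule.Quotient.mk (v i ⊗ₜ[ℤ] Pi.single i 1)
      map_add' v w := by
        simp [TensorProduct.add_tmul, Finset.sum_add_distrib]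
      map_smul' c v := by
        simp only [RingHom.id_apply, Finset.smul_sum]
        rfl }
    (by
      ext v i
      simp [extendScalarsPiHom_mk_tmul, Pi.single_apply])
    (by
      refine extendScalars_hom_ext f fun b m ↦ ?_
      have : ∑ i, MulOpposite.op (m i) • (Pi.single i 1 : Fin n → A) = m := by
        ext j
        simp [Pi.single_apply]
      refine Eq.trans ?_ (congrArg (fun m ↦ (extendScalarsRel f (Fin n → A)).mkQ (b ⊗ₜ[ℤ] m)) this)
      rw [TensorProduct.tmul_sum, map_sum]
      change ∑ i, (extendScalarsRel f (Fin n → A)).mkQ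
        ((f (m i) * b) ⊗ₜ[ℤ] (Pi.single i (1 : A) : Fin n → A)) = _
      exact Finset.sum_congr rfl fun i _ ↦
        extendScalars_mk_smul_tmul f (m i) b (Pi.single i (1 : A) : Fin n → A))

end ExtendScalars

namespace FGRightMod

variable (R : Type u) {Λ Γ : Type u} [CommRing R] [Ring Λ] [Algebra R Λ] [Ring Γ] [Algebra R Γ]

variable (Λ) in
instance finite_op_self : Module.Finite Λᵐᵒᵖ Λ :=
  ⟨⟨{1}, by
    rw [eq_top_iff]
    intro x _
    rw [Finset.coe_singleton, Submodule.mem_span_singleton]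
    exact ⟨MulOpposite.op x, by simp⟩⟩⟩

variable (Λ) in
/-- The isomorphism of right modules between `(Λᵒᵖ)ⁿ` and `Λⁿ`. -/
def piOpEquiv (n : ℕ) : (Fin n → Λᵐᵒᵖ) ≃ₗ[Λᵐᵒᵖ] (Fin n → Λ) where
  toFun v i := (v i).unop
  invFun v i := MulOpposite.op (v i)
  map_add' _ _ := rfl
  map_smul' _ _ := rfl

instance : (toModuleCat R Λ).Faithful :=
  inferInstanceAs (forget₂ (FGModuleCat.{u} Λᵐᵒᵖ) (ModuleCat.{u} Λᵐᵒᵖ)).Faithful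

instance : (toModuleCat R Λ).Full :=
  inferInstanceAs (forget₂ (FGModuleCat.{u} Λᵐᵒᵖ) (ModuleCat.{u} Λᵐᵒᵖ)).Full

variable (Λ) in
/-- The right module `Λⁿ`. -/
def free (n : ℕ) : FGRightMod R Λ := FGModuleCat.of Λᵐᵒᵖ (Fin n → Λ)

instance (n : ℕ) : Projective ((toModuleCat R Λ).obj (free R Λ n)) :=
  (IsProjective.iff_projective (Fin n → Λ)).1 (Module.Projective.of_equiv (piOpEquiv Λ n))

instance (n : ℕ) : Projective (free R Λ n) where
  factors f e _ :=
    ⟨(toModuleCat R Λ).preimage (Projective.factorThru ((toModuleCat R Λ).map f)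
      ((toModuleCat R Λ).map e)), (toModuleCat R Λ).map_injective (by
        rw [Functor.map_comp, Functor.map_preimage, Projective.factorThru_comp])⟩

lemma isZero_free_zero : IsZero (free R Λ 0) :=
  (IsZero.iff_id_eq_zero _).2 (FGModuleCat.hom_ext (LinearMap.ext fun _ ↦ funext fun i ↦ i.elim0))

lemma exists_epi_free (X : FGRightMod R Λ) : ∃ (n : ℕ) (p : free R Λ n ⟶ X), Epi p := by
  obtain ⟨n, g, hg⟩ := Module.Finite.exists_fin' Λᵐᵒᵖ ((toModuleCat R Λ).obj X)
  let p : free R Λ n ⟶ X := (toModuleCat R Λ).preimage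
    (ModuleCat.ofHom (g.comp (piOpEquiv Λ n).symm.toLinearMap))
  have : Epi ((toModuleCat R Λ).map p) := by
    rw [show (toModuleCat R Λ).map p = _ from Functor.map_preimage _ _]
    exact (ModuleCat.epi_iff_surjective _).2 (hg.comp (piOpEquiv Λ n).symm.surjective)
  exact ⟨n, p, (toModuleCat R Λ).epi_of_epi_map this⟩

/-- The morphism `Λⁿ ⟶ Λᵐ` given by a matrix. -/
def ofMatrix {m n : ℕ} (A : Matrix (Fin m) (Fin n) Λ) : free R Λ n ⟶ free R Λ m :=
  FGModuleCat.ofHom (Matrix.mulVecBilin Λ Λᵐᵒᵖ A)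

/-- Matrices act on columns from the left, which commutes with the right action of `Λ`; composition
in diagrammatic order reverses the product. -/
lemma ofMatrix_comp {l m n : ℕ} (A : Matrix (Fin m) (Fin n) Λ) (B : Matrix (Fin l) (Fin m) Λ) :
    ofMatrix R A ≫ ofMatrix R B = ofMatrix R (B * A) := by
  apply FGModuleCat.hom_ext
  ext v : 1
  exact Matrix.mulVec_mulVec v B A

lemma ofMatrix_add {m n : ℕ} (A B : Matrix (Fin m) (Fin n) Λ) :
    ofMatrix R (A + B) = ofMatrix R A + ofMatrix R B := by
  apply FGModuleCat.hom_ext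
  ext v : 1
  exact Matrix.add_mulVec A B v

lemma ofMatrix_zero {m n : ℕ} : ofMatrix R (0 : Matrix (Fin m) (Fin n) Λ) = 0 := by
  apply FGModuleCat.hom_ext
  ext v : 1
  exact Matrix.zero_mulVec v

lemma ofMatrix_injective {m n : ℕ} :
    Function.Injective (ofMatrix R : Matrix (Fin m) (Fin n) Λ → _) := fun A B h ↦ by
  ext i j
  have h' : A.mulVec (Pi.single j 1) = B.mulVec (Pi.single j 1) :=
    congrArg (fun f ↦ (f.hom.hom : (Fin n → Λ) →ₗ[Λᵐᵒᵖ] (Fin m → Λ)) (Pi.single j 1)) h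
  simpa using congrFun h' i

lemma exists_map_ofMatrix_eq {m n : ℕ} (g : (toModuleCat R Λ).obj (free R Λ n) ⟶
      (toModuleCat R Λ).obj (free R Λ m)) :
    ∃ A : Matrix (Fin m) (Fin n) Λ, (toModuleCat R Λ).map (ofMatrix R A) = g := by
  let f : (Fin n → Λ) →ₗ[Λᵐᵒᵖ] (Fin m → Λ) := g.hom
  refine ⟨Matrix.of fun i j ↦ f (Pi.single j 1) i, ?_⟩
  apply ModuleCat.hom_ext
  change Matrix.mulVecBilin Λ Λᵐᵒᵖ _ = f
  ext j i
  simp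

lemma exists_ofMatrix_eq {m n : ℕ} (g : free R Λ n ⟶ free R Λ m) :
    ∃ A : Matrix (Fin m) (Fin n) Λ, ofMatrix R A = g := by
  obtain ⟨A, hA⟩ := exists_map_ofMatrix_eq R ((toModuleCat R Λ).map g)
  exact ⟨A, (toModuleCat R Λ).map_injective hA⟩

/-- The extension of scalars of `Λⁿ` is `Γⁿ`. -/
def extendScalarsFreeIso (f : Λ →ₐ[R] Γ) (n : ℕ) :
    (extendScalars R f).obj (free R Λ n) ≅ free R Γ n where
  hom := FGModuleCat.ofHom (extendScalarsPiEquiv f.toRingHom n).toLinearMap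
  inv := FGModuleCat.ofHom (extendScalarsPiEquiv f.toRingHom n).symm.toLinearMap
  hom_inv_id := FGModuleCat.hom_ext (extendScalarsPiEquiv f.toRingHom n).symm_comp
  inv_hom_id := FGModuleCat.hom_ext (extendScalarsPiEquiv f.toRingHom n).comp_symm

lemma extendScalarsFreeIso_hom_naturality (f : Λ →ₐ[R] Γ) {m n : ℕ}
    (A : Matrix (Fin m) (Fin n) Λ) :
    (extendScalars R f).map (ofMatrix R A) ≫ (extendScalarsFreeIso R f m).hom =
      (extendScalarsFreeIso R f n).hom ≫ ofMatrix R (A.map f) := by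
  apply FGModuleCat.hom_ext
  refine extendScalars_hom_ext _ fun b (v : Fin n → Λ) ↦ funext fun i ↦ ?_
  change f (∑ k, A i k * v k) * b = ∑ k, f (A i k) * (f (v k) * b)
  simp [Finset.sum_mul, mul_assoc]

end FGRightMod

/-! ### Complexes given by matrices. -/

namespace FGRightMod

open CochainComplex HomComplex

variable (R : Type u) {Λ Γ : Type u} [CommRing R] [Ring Λ] [Algebra R Λ] [Ring Γ] [Algebra R Γ]
  {n : ℤ → ℕ}

/-- The complex of finitely generated free right modules given by a sequence of matrices. -/
abbrev matrixComplex (A : ∀ i : ℤ, Matrix (Fin (n (i + 1))) (Fin (n i)) Γ)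
    (hA : ∀ i, A (i + 1) * A i = 0) : CochainComplex (FGRightMod R Γ) ℤ :=
  CochainComplex.of (fun i ↦ free R Γ (n i)) (fun i ↦ ofMatrix R (A i)) fun i ↦ by
    rw [ofMatrix_comp, hA, ofMatrix_zero]

section

variable (A : ∀ i : ℤ, Matrix (Fin (n (i + 1))) (Fin (n i)) Γ) (hA : ∀ i, A (i + 1) * A i = 0)

lemma isStrictlyLE_matrixComplex (N : ℤ) (hN : ∀ i, N < i → n i = 0) :
    (matrixComplex R A hA).IsStrictlyLE N := by
  rw [isStrictlyLE_iff]
  intro i hi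
  change IsZero (free R Γ (n i))
  rw [hN i hi]
  exact isZero_free_zero R

/-- K-projectivity is needed among all right modules, since the hypothesis on `P` concerns morphisms
in the derived category of all modules. -/
lemma isKProjective_map_matrixComplex (N : ℤ) (hN : ∀ i, N < i → n i = 0) :
    IsKProjective (((toModuleCat R Γ).mapHomologicalComplex _).obj (matrixComplex R A hA)) := by
  have : CochainComplex.IsStrictlyLE
      (((toModuleCat R Γ).mapHomologicalComplex _).obj (matrixComplex R A hA)) N := by
    rw [isStrictlyLE_iff]
    intro i hi
    have := isStrictlyLE_matrixComplex R A hA N hN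
    exact (toModuleCat R Γ).map_isZero ((matrixComplex R A hA).isZero_of_isStrictlyLE N i hi)
  have (i : ℤ) : Projective
      ((((toModuleCat R Γ).mapHomologicalComplex _).obj (matrixComplex R A hA)).X i) :=
    inferInstanceAs (Projective ((toModuleCat R Γ).obj (free R Γ (n i))))
  exact isKProjective_of_projective _ N

/-- If a bounded above complex of finitely generated free right modules has no nonzero
endomorphisms of degree two in the derived category, then every endomorphism of degree two is
null-homotopic. -/
lemma exists_homotopy_of_forall_eq_zero [HasDerivedCategory.{w₁} (ModuleCat.{u} Γᵐᵒᵖ)]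
    (N : ℤ) (hN : ∀ i, N < i → n i = 0)
    (h0 : ∀ g : DerivedCategory.Q.obj
        (((toModuleCat R Γ).mapHomologicalComplex _).obj (matrixComplex R A hA)) ⟶
      (DerivedCategory.Q.obj
        (((toModuleCat R Γ).mapHomologicalComplex _).obj (matrixComplex R A hA)))⟦(2 : ℤ)⟧, g = 0)
    (f : ∀ i : ℤ, Matrix (Fin (n (i + 1 + 1))) (Fin (n i)) Γ)
    (hf : ∀ i, A (i + 1 + 1) * f i - f (i + 1) * A i = 0) :
    ∃ h : ∀ i : ℤ, Matrix (Fin (n (i + 1))) (Fin (n i)) Γ,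
      ∀ i, f i - (A (i + 1) * h i + h (i + 1) * A i) = 0 := by
  let F := toModuleCat R Γ
  let K := (F.mapHomologicalComplex (ComplexShape.up ℤ)).obj (matrixComplex R A hA)
  have hd (i : ℤ) : K.d i (i + 1) = F.map (ofMatrix R (A i)) :=
    congrArg (fun g : free R Γ (n i) ⟶ free R Γ (n (i + 1)) ↦ F.map g)
      (CochainComplex.of_d (fun i ↦ free R Γ (n i)) (fun i ↦ ofMatrix R (A i)) i)
  let z : Cochain K K 2 := Cochain.mk fun p q hpq ↦ F.map (ofMatrix R (f p)) ≫ eqToHom (by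
    obtain rfl : q = p + 1 + 1 := by lia
    rfl)
  have hz (p : ℤ) (hp : p + 2 = p + 1 + 1) : z.v p (p + 1 + 1) hp = F.map (ofMatrix R (f p)) :=
    Category.comp_id _
  have hδ : δ 2 3 z = 0 := by
    ext p q hpq : 1
    obtain rfl : q = p + 1 + 1 + 1 := by lia
    -- The sign `(-1)³` turns the cocycle condition into the commutation `hf`; the sign `(-1)²` used
    -- below gives `d h + h d`.
    rw [δ_v 2 3 rfl _ _ _ _ (p + 1 + 1) (p + 1) (by lia) rfl, hz, hz, hd, hd,
      Int.negOnePow_odd 3 (by decide), Cochain.zero_v, Units.neg_smul, one_smul]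
    refine add_neg_eq_zero.2 ?_
    change F.map (ofMatrix R (f p)) ≫ F.map (ofMatrix R (A (p + 1 + 1))) =
      F.map (ofMatrix R (A p)) ≫ F.map (ofMatrix R (f (p + 1)))
    rw [← F.map_comp, ← F.map_comp, ofMatrix_comp, ofMatrix_comp, sub_eq_zero.1 (hf p)]
  have := isKProjective_map_matrixComplex R A hA N hN
  obtain ⟨w, hw⟩ := exists_δ_eq_of_forall_eq_zero K 2 1 rfl h0 (Cocycle.mk z 3 rfl hδ)
  choose h hh using fun i ↦ exists_map_ofMatrix_eq R (w.v i (i + 1) rfl)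
  refine ⟨h, fun i ↦ sub_eq_zero.2 (ofMatrix_injective R (F.map_injective ?_))⟩
  have key := Cochain.congr_v hw i (i + 1 + 1) (by lia)
  rw [δ_v 1 2 rfl _ _ _ _ (i + 1) (i + 1) (by lia) rfl, hd, hd, ← hh, ← hh,
    Int.negOnePow_even 2 (by decide), one_smul] at key
  rw [ofMatrix_add, F.map_add, ← ofMatrix_comp, ← ofMatrix_comp, F.map_comp, F.map_comp]
  exact (hz i (by lia)).symm.trans key.symm

end

/-- Extension of scalars of a complex of free modules given by matrices. -/
noncomputable def extendScalarsMatrixComplexIso (f : Λ →ₐ[R] Γ)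
    (D : ∀ i : ℤ, Matrix (Fin (n (i + 1))) (Fin (n i)) Λ) (hD : ∀ i, D (i + 1) * D i = 0)
    (A : ∀ i : ℤ, Matrix (Fin (n (i + 1))) (Fin (n i)) Γ) (hA : ∀ i, A (i + 1) * A i = 0)
    (h : ∀ i, (D i).map f = A i) :
    ((extendScalars R f).mapHomologicalComplex _).obj (matrixComplex R D hD) ≅
      matrixComplex R A hA :=
  HomologicalComplex.Hom.isoOfComponents (fun i ↦ extendScalarsFreeIso R f (n i)) (by
    rintro i _ rfl
    have := extendScalarsFreeIso_hom_naturality R f (D i)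
    rw [h] at this
    simp only [of_d, Functor.mapHomologicalComplex_obj_d]
    exact this.symm)

variable {R}

/-- As `R` is central in `Λ`, the ideal generated by the image of `𝔞` is the `R`-submodule `𝔞Λ`:
left multiplications are `R`-linear and preserve it. -/
lemma map_mk_eq_zero_iff {m n : ℕ} (𝔞 : Ideal R) (M : Matrix (Fin m) (Fin n) Λ) :
    M.map (Ideal.Quotient.mkₐ R (𝔞.map (algebraMap R Λ))) = 0 ↔
      M ∈ Matrix.adicSubmodule 𝔞 (Fin m) (Fin n) 1 := by
  have key (x : Λ) : x ∈ 𝔞.map (algebraMap R Λ) ↔ x ∈ (𝔞 ^ 1 • ⊤ : Submodule R Λ) := by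
    rw [pow_one]
    constructor
    · intro hx
      induction hx using Submodule.span_induction with
      | mem x hx =>
        obtain ⟨r, hr, rfl⟩ := hx
        rw [Algebra.algebraMap_eq_smul_one]
        exact Submodule.smul_mem_smul hr trivial
      | zero => exact zero_mem _
      | add x y _ _ hx hy => exact add_mem hx hy
      | smul c x _ hx =>
        have := Submodule.mem_map_of_mem (f := LinearMap.mulLeft R c) hx
        rw [Submodule.map_smul''] at this
        exact Submodule.smul_mono le_rfl le_top this
    · intro hx
      refine Submodule.smul_induction_on hx (fun r hr x _ ↦ ?_) fun x y ↦ add_mem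
      rw [Algebra.smul_def]
      exact Ideal.mul_mem_right _ _ (Ideal.mem_map_of_mem _ hr)
  simp only [← Matrix.ext_iff, Matrix.mem_adicSubmodule, ← key]
  exact forall₂_congr fun i j ↦ Ideal.Quotient.eq_zero_iff_mem

end FGRightMod

/-! ### The main theorem. -/

open FGRightMod in
theorem mainTheorem6 {R Λ : Type u} [CommRing R] [IsNoetherianRing R] [IsLocalRing R]
    [IsAdicComplete (IsLocalRing.maximalIdeal R) R] [Ring Λ] [Algebra R Λ] [Module.Finite R Λ]
    (𝔞 : Ideal R) (h𝔞 : 𝔞 ≠ ⊤) (hTor : TorIndependent R Λ (R ⧸ 𝔞)) (hflat : IsNormallyFlat 𝔞)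
    [HasDerivedCategory.{w₁} (FGRightMod R Λ)]
    [HasDerivedCategory.{w₂} (FGRightMod R (Λ ⧸ 𝔞.map (algebraMap R Λ)))]
    [HasDerivedCategory.{w₃} (ModuleCat.{u} (Λ ⧸ 𝔞.map (algebraMap R Λ))ᵐᵒᵖ)] :
    (∀ n : ℕ, TorIndependent R Λ (R ⧸ 𝔞 ^ n)) ∧
    ∀ P : DerivedCategory.Minus (FGRightMod R (Λ ⧸ 𝔞.map (algebraMap R Λ))),
      (∀ g : (FGRightMod.toModuleCat R (Λ ⧸ 𝔞.map (algebraMap R Λ))).mapDerivedCategory.obj P.obj ⟶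
        ((FGRightMod.toModuleCat R (Λ ⧸ 𝔞.map (algebraMap R Λ))).mapDerivedCategory.obj
          P.obj)⟦(2 : ℤ)⟧, g = 0) →
      ∃ L : DerivedCategory.Minus (FGRightMod R Λ),
        Nonempty ((FGRightMod.reduction R Λ 𝔞).leftDerivedFunctorMinus.obj L ≅ P) := by
  refine ⟨hTor.quotient_pow h𝔞 hflat, fun P hP ↦ ?_⟩
  obtain ⟨n, d, sq, N, hN, ⟨e⟩⟩ := DerivedCategory.Minus.exists_free (free := free R _)
    (fun _ ↦ inferInstance) (exists_epi_free R) (isZero_free_zero R) P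
  choose A hA using fun i ↦ exists_ofMatrix_eq R (d i)
  obtain rfl : (fun i ↦ ofMatrix R (A i)) = d := funext hA
  have hA' (i : ℤ) : A (i + 1) * A i = 0 := ofMatrix_injective R (by
    rw [← ofMatrix_comp, sq, ofMatrix_zero])
  let π := Ideal.Quotient.mkₐ R (𝔞.map (algebraMap R Λ))
  have hmem {m k : ℕ} (M : Matrix (Fin m) (Fin k) Λ) :
      M.map π = 0 ↔ M ∈ Matrix.adicSubmodule 𝔞 (Fin m) (Fin k) 1 := map_mk_eq_zero_iff 𝔞 M
  have hπ (m k : ℕ) (M : Matrix (Fin m) (Fin k) (Λ ⧸ 𝔞.map (algebraMap R Λ))) :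
      ∃ M' : Matrix (Fin m) (Fin k) Λ, M'.map π = M := by
    choose M' hM' using fun i j ↦ Ideal.Quotient.mkₐ_surjective R _ (M i j)
    exact ⟨M', Matrix.ext hM'⟩
  choose D₀ hD₀ using fun i ↦ hπ _ _ (A i)
  let e' : (toModuleCat R _).mapDerivedCategory.obj P.obj ≅
      DerivedCategory.Q.obj (((toModuleCat R _).mapHomologicalComplex _).obj
        (matrixComplex R A hA')) :=
    (toModuleCat R _).mapDerivedCategory.mapIso e.symm ≪≫
      (toModuleCat R _).mapDerivedCategoryFactors.app _
  have hunob : IsUnobstructed 𝔞 D₀ := by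
    constructor
    · intro i
      rw [← hmem, Matrix.map_mul, hD₀, hD₀, hA']
    · intro f hf
      obtain ⟨h, hh⟩ := exists_homotopy_of_forall_eq_zero R A hA' N hN (fun g ↦ by
        -- Conjugation by `e'` moves the vanishing hypothesis from `P` to the matrix complex.
        have := hP (e'.hom ≫ g ≫ e'.inv⟦(2 : ℤ)⟧')
        simpa [Preadditive.IsIso.comp_left_eq_zero, Preadditive.IsIso.comp_right_eq_zero]
          using this) (fun i ↦ (f i).map π) fun i ↦ by
          simpa only [Matrix.map_sub _ (map_sub π), Matrix.map_mul, hD₀] using (hmem _).2 (hf i)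
      choose h' hh' using fun i ↦ hπ _ _ (h i)
      refine ⟨h', fun i ↦ ?_⟩
      simpa only [← hmem, Matrix.map_sub _ (map_sub π), Matrix.map_add _ (map_add π),
        Matrix.map_mul, hD₀, hh'] using hh i
  obtain ⟨D, hD, hD2⟩ := hunob.exists_lift h𝔞 (fun k hk ↦ by
    obtain ⟨c, x, h1, h2, h3⟩ := hflat.exists_basis h𝔞 hTor hk
    exact ⟨c, x, h1, h2, h3⟩)
  have hDA (i : ℤ) : (D i).map π = A i := by
    simpa only [← hmem, Matrix.map_sub _ (map_sub π), hD₀, sub_eq_zero] using hD i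
  have := isStrictlyLE_matrixComplex R D hD2 N hN
  exact (reduction R Λ 𝔞).exists_leftDerivedFunctorMinus_obj_iso (matrixComplex R D hD2)
    (fun i ↦ inferInstanceAs (Projective (free R Λ (n i)))) N P
    (DerivedCategory.Q.mapIso (extendScalarsMatrixComplexIso R π D hD2 A hA' hDA) ≪≫ e)
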